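/- **Setting.** Fix a relational schema: finitely many relations $R$, each with a finite list of distinct attributes (relations may share attributes), a set $\mathcal F$ of *fixable* attributes (all other attributes are *rigid*), and for each $R$ a primary key $K_R$ consisting of rigid attributes. Constants are rational numbers and symbolic names; order comparisons hold between numbers only. A database instance $D$ is a finite set of rows for every relation, with integer values in all fixable attributes. A *linear denial* is a sentence $\forall\bar x\,\neg(A_1\wedge\dots\wedge A_k)$ whose conjuncts are database atoms $R(x_1,\dots,x_n)$ (with variables as arguments) and built-in atoms $x\,\theta\,c$ with $\theta\in\{=,\neq,<,>,\le,\ge\}$ and $c$ a constant, or $x=y$; every variable of a built-in atom occurs in a database atom. A finite set $IC$ of linear denials is *local* if (a) attributes participating in atoms $x=y$ or in joins (i.e. at which a variable with more than one occurrence in the database atoms of a denial occurs) are all rigid; (b) every denial of $IC$ has a built-in atom with a variable that occurs at a fixable attribute; (c) no attribute appears in $IC$ both in comparisons of the form $A<c_1$ and of the form $A>c_2$, where $\le$ counts as $<$, $\ge$ counts as $>$, and $\neq$ counts as both. For $D$ satisfying the key constraints, a *fix* of $D$ with respect to $IC$ is an instance $D'$ with the same rigid values as $D$ (every row of either instance has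 a row of the same relation in the other one that agrees with it on all rigid attributes) that satisfies the key constraints and $IC$. The square distance is $$\Delta(D,D')=\sum_{R}\ \sum_{\bar k}\ \sum_{A\in\mathcal F}\bigl(t_A-t'_A\bigr)^2,$$ where $\bar k$ ranges over the key values of $R$ in $D$, where $t,t'$ are the rows of $R$ with key value $\bar k$ in $D$ and in $D'$, and where $A$ ranges over the fixable attributes of $R$. An *LS-fix* of $D$ is a fix that minimizes $\Delta(D,\cdot)$ among all fixes. **Theorem.** For every schema and every finite local set $IC$ of linear denials there are a constant $c$ and a polynomial-time algorithm (the running time is measured in the size of the database, with numbers written in binary) that, given any database instance $D$ satisfying the key constraints, returns a fix $\hat D$ of $D$ with respect to $IC$ such that $\Delta(D,\hat D)\le c\cdot\Delta(D,D')$ for every LS-fix $D'$ of $D$. The constant $c$ does not depend on $D$. -/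

import Mathlib

/-!
Databases with integer valued fixable attributes, local linear denial constraints, least squares
fixes, and a While language with a step count for stating polynomial running times.
-/

namespace DBFix

/-! ### Domain, schemas and instances -/

/-- The domain of constants: numbers (the integers among them) and symbolic names. -/
inductive Value where
  | num (q : ℚ)
  | name (n : ℕ)
  deriving DecidableEq

/-- The number denoted by a numerical value; only used on fixable attributes, where all values
are integers. -/
def Value.toRat : Value → ℚ
  | .num q => q
  | .name _ => 0

/-- `v` is an integer of the domain. -/
def Value.IsInt (v : Value) : Prop := ∃ z : ℤ, v = .num z

/-- A relational schema: finitely many relations, each with a finite list of distinct attributes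
(different relations may share attributes), a set of fixable attributes, and for every relation a
primary key that consists of rigid, that is non-fixable, attributes. -/
structure Schema where
  /-- attribute names -/
  Attr : Type
  /-- number of relations -/
  numRel : ℕ
  /-- number of attributes of a relation -/
  arity : Fin numRel → ℕ
  /-- the attribute at a position of a relation -/
  attr : (R : Fin numRel) → Fin (arity R) → Attr
  attr_injective : ∀ R, Function.Injective (attr R)
  /-- the fixable attributes -/
  fixable : Set Attr
  /-- the positions that form the primary key of a relation -/
  key : (R : Fin numRel) → Set (Fin (arity R))
  key_rigid : ∀ R, ∀ i ∈ key R, attr R i ∉ fixable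

/-- The relation symbols of a schema. -/
abbrev Schema.Rel (S : Schema) : Type := Fin S.numRel

/-- A row (tuple of constants) for the relation `R`. -/
abbrev Row (S : Schema) (R : S.Rel) : Type := Fin (S.arity R) → Value

/-- A database instance: a finite set of rows for every relation, with integers in all fixable
attributes. -/
structure Instance (S : Schema) where
  /-- the rows of a relation -/
  rows : (R : S.Rel) → Finset (Row S R)
  typed : ∀ R, ∀ t ∈ rows R, ∀ i, S.attr R i ∈ S.fixable → (t i).IsInt

/-- Two rows have the same key values. -/
def SameKey {S : Schema} {R : S.Rel} (t t' : Row S R) : Prop := ∀ i ∈ S.key R, t i = t' i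

/-- Two rows have the same values in all rigid attributes. -/
def SameRigid {S : Schema} {R : S.Rel} (t t' : Row S R) : Prop :=
  ∀ i, S.attr R i ∉ S.fixable → t i = t' i

/-- The instance satisfies the key constraints of the schema. -/
def Instance.SatisfiesKeys {S : Schema} (D : Instance S) : Prop :=
  ∀ R, ∀ t ∈ D.rows R, ∀ t' ∈ D.rows R, SameKey t t' → t = t'

/-! ### Linear denial constraints -/

/-- The comparison symbols of built-in atoms. -/
inductive CmpOp where
  | eq | ne | lt | gt | le | ge
  deriving DecidableEq

/-- Truth of `v θ c`. The order comparisons hold between numbers only. -/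
def CmpOp.Holds : CmpOp → Value → Value → Prop
  | .eq, v, c => v = c
  | .ne, v, c => v ≠ c
  | .lt, .num p, .num q => p < q
  | .gt, .num p, .num q => q < p
  | .le, .num p, .num q => p ≤ q
  | .ge, .num p, .num q => q ≤ p
  | _, _, _ => False

/-- A database atom `R(x₁, …, xₙ)`; variables are natural numbers. -/
structure DBAtom (S : Schema) where
  /-- the predicate -/
  rel : S.Rel
  /-- the variables -/
  args : Fin (S.arity rel) → ℕ

/-- Built-in atoms: `x θ c` with a constant `c`, and `x = y`. -/
inductive BuiltIn where
  | cmp (x : ℕ) (θ : CmpOp) (c : Value)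
  | eq (x y : ℕ)

/-- The variables of a built-in atom. -/
def BuiltIn.vars : BuiltIn → Set ℕ
  | .cmp x _ _ => {x}
  | .eq x y => {x, y}

/-- Truth of a built-in atom under a valuation of the variables. -/
def BuiltIn.Holds (ν : ℕ → Value) : BuiltIn → Prop
  | .cmp x θ c => θ.Holds (ν x) c
  | .eq x y => ν x = ν y

/-- The argument positions in a list of database atoms. -/
abbrev Pos {S : Schema} (as : List (DBAtom S)) : Type :=
  (j : Fin as.length) × Fin (S.arity (as.get j).rel)

/-- The variable at an argument position. -/
def Pos.var {S : Schema} {as : List (DBAtom S)} (p : Pos as) : ℕ := (as.get p.1).args p.2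

/-- The attribute at an argument position. -/
def Pos.attr {S : Schema} {as : List (DBAtom S)} (p : Pos as) : S.Attr :=
  S.attr (as.get p.1).rel p.2

/-- A linear denial constraint `∀ x̄ ¬ (A₁ ∧ … ∧ Aₘ)` whose conjuncts are database atoms and
built-in atoms. Every variable of a built-in atom occurs in a database atom, so that built-in
atoms speak about attributes. -/
structure LinearDenial (S : Schema) where
  /-- the database atoms -/
  atoms : List (DBAtom S)
  /-- the built-in atoms -/
  builtIns : List BuiltIn
  safe : ∀ b ∈ builtIns, ∀ x ∈ b.vars, ∃ p : Pos atoms, p.var = x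

/-- The instance satisfies the denial: no valuation makes all its atoms true. -/
def Instance.Satisfies {S : Schema} (D : Instance S) (ic : LinearDenial S) : Prop :=
  ¬ ∃ ν : ℕ → Value,
    (∀ a ∈ ic.atoms, (fun i => ν (a.args i)) ∈ D.rows a.rel) ∧ ∀ b ∈ ic.builtIns, b.Holds ν

/-- Some denial of `IC` contains an atom `x θ c` with `θ ∈ Θ` where `x` occurs at attribute `A`. -/
def ComparedBy {S : Schema} (IC : Finset (LinearDenial S)) (Θ : Set CmpOp) (A : S.Attr) : Prop :=
  ∃ ic ∈ IC, ∃ p : Pos ic.atoms, p.attr = A ∧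
    ∃ θ ∈ Θ, ∃ c : Value, BuiltIn.cmp p.var θ c ∈ ic.builtIns

/-- Local sets of linear denials. For the last condition, `≤`, `≥` and `≠` are expressed through
`<` and `>`: so `≤` counts as `<`, `≥` counts as `>`, and `≠` counts as both. -/
structure IsLocal {S : Schema} (IC : Finset (LinearDenial S)) : Prop where
  /-- attributes in equality atoms between attributes are rigid -/
  eq_rigid : ∀ ic ∈ IC, ∀ x y, BuiltIn.eq x y ∈ ic.builtIns →
    ∀ p : Pos ic.atoms, p.var = x ∨ p.var = y → p.attr ∉ S.fixable
  /-- attributes in joins are rigid -/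
  join_rigid : ∀ ic ∈ IC, ∀ p q : Pos ic.atoms, p ≠ q → p.var = q.var →
    p.attr ∉ S.fixable ∧ q.attr ∉ S.fixable
  /-- each denial has a built-in atom with a fixable attribute -/
  fixable_builtIn : ∀ ic ∈ IC, ∃ b ∈ ic.builtIns, ∃ p : Pos ic.atoms,
    p.var ∈ b.vars ∧ p.attr ∈ S.fixable
  /-- no attribute appears both in comparisons `A < c₁` and `A > c₂` -/
  one_sided : ∀ A : S.Attr,
    ¬ (ComparedBy IC {.lt, .le, .ne} A ∧ ComparedBy IC {.gt, .ge, .ne} A)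

/-! ### Fixes and the square distance -/

open Classical in
/-- Sum of the squared differences of two rows over the fixable attributes. -/
noncomputable def rowDist {S : Schema} {R : S.Rel} (t t' : Row S R) : ℚ :=
  ∑ i with S.attr R i ∈ S.fixable, ((t i).toRat - (t' i).toRat) ^ 2

open Classical in
/-- The square distance, with all weights equal to one: every row of `D` is compared with the row
of `D'` that has the same key values. (If both instances satisfy the key constraints and have the
same key values, there is exactly one such row.) -/
noncomputable def sqDist {S : Schema} (D D' : Instance S) : ℚ :=
  ∑ R : S.Rel, ∑ t ∈ D.rows R, ∑ t' ∈ D'.rows R with SameKey t t', rowDist t t'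

/-- `D'` is a fix of `D` with respect to `IC`: it has the same rigid values as `D`, and satisfies
the key constraints and `IC`. -/
structure IsFix {S : Schema} (IC : Finset (LinearDenial S)) (D D' : Instance S) : Prop where
  rigid : ∀ R, ∀ t ∈ D.rows R, ∃ t' ∈ D'.rows R, SameRigid t t'
  rigid' : ∀ R, ∀ t' ∈ D'.rows R, ∃ t ∈ D.rows R, SameRigid t t'
  keys : D'.SatisfiesKeys
  ics : ∀ ic ∈ IC, D'.Satisfies ic

/-- Least squares fixes: fixes at minimum square distance. -/
def IsLSFix {S : Schema} (IC : Finset (LinearDenial S)) (D D' : Instance S) : Prop :=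
  IsFix IC D D' ∧ ∀ D'', IsFix IC D D'' → sqDist D D' ≤ sqDist D D''

/-! ### A While language with a step count

Programs work on binary trees with integer leaves. Every evaluation of an operation is charged
the size of the tree that it produces (its operands have been charged before), integers being
measured by their binary length. So a run with cost `t` can be simulated by a Turing machine in
time polynomial in `t`, and conversely; polynomial time has its usual meaning. -/

/-- Binary trees with integers at the leaves. -/
inductive Data where
  | int (z : ℤ)
  | pair (a b : Data)

namespace Data

/-- The size of a tree, with integers in binary. -/
def size : Data → ℕ
  | int z => 1 + z.natAbs.size
  | pair a b => 1 + a.size + b.size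

/-- The integer at a leaf. -/
def toInt : Data → ℤ
  | int z => z
  | pair _ _ => 0

/-- First component of a pair. -/
def fst : Data → Data
  | int _ => int 0
  | pair a _ => a

/-- Second component of a pair. -/
def snd : Data → Data
  | int _ => int 0
  | pair _ b => b

/-- The integer `1` for a pair, and `0` for a leaf. -/
def isPair : Data → Data
  | int _ => int 0
  | pair _ _ => int 1

/-- Lists are coded by nested pairs that end in the leaf `0`. -/
def ofList : List Data → Data
  | [] => int 0
  | d :: ds => pair d (ofList ds)

end Data

/-- The contents of the program variables. -/
abbrev Store : Type := ℕ → Data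

/-- Expressions of the While language. -/
inductive WExpr where
  | var (x : ℕ)
  | const (z : ℤ)
  | pair (e f : WExpr)
  | fst (e : WExpr)
  | snd (e : WExpr)
  | isPair (e : WExpr)
  | add (e f : WExpr)
  | sub (e f : WExpr)
  | mul (e f : WExpr)
  | le (e f : WExpr)

/-- The value of an expression; `le` yields `1` for true and `0` for false. -/
def WExpr.eval (σ : Store) : WExpr → Data
  | var x => σ x
  | const z => .int z
  | pair e f => .pair (e.eval σ) (f.eval σ)
  | fst e => (e.eval σ).fst
  | snd e => (e.eval σ).snd
  | isPair e => (e.eval σ).isPair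
  | add e f => .int ((e.eval σ).toInt + (f.eval σ).toInt)
  | sub e f => .int ((e.eval σ).toInt - (f.eval σ).toInt)
  | mul e f => .int ((e.eval σ).toInt * (f.eval σ).toInt)
  | le e f => .int (if (e.eval σ).toInt ≤ (f.eval σ).toInt then 1 else 0)

/-- The cost of evaluating an expression: the sizes of the values of all its subexpressions. -/
def WExpr.cost (σ : Store) : WExpr → ℕ
  | var x => (var x).eval σ |>.size
  | const z => (const z).eval σ |>.size
  | pair e f => ((pair e f).eval σ).size + e.cost σ + f.cost σ
  | fst e => ((fst e).eval σ).size + e.cost σ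
  | snd e => ((snd e).eval σ).size + e.cost σ
  | isPair e => ((isPair e).eval σ).size + e.cost σ
  | add e f => ((add e f).eval σ).size + e.cost σ + f.cost σ
  | sub e f => ((sub e f).eval σ).size + e.cost σ + f.cost σ
  | mul e f => ((mul e f).eval σ).size + e.cost σ + f.cost σ
  | le e f => ((le e f).eval σ).size + e.cost σ + f.cost σ

/-- Programs of the While language. -/
inductive WProg where
  | skip
  | assign (x : ℕ) (e : WExpr)
  | seq (P Q : WProg)
  | cond (e : WExpr) (P Q : WProg)
  | loop (e : WExpr) (P : WProg)

/-- `Exec P σ σ' t`: started in the store `σ`, the program `P` halts in the store `σ'` with cost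
`t`. A test succeeds if its value is not the leaf `0`. -/
inductive Exec : WProg → Store → Store → ℕ → Prop
  | skip (σ : Store) : Exec .skip σ σ 1
  | assign (σ : Store) (x : ℕ) (e : WExpr) :
      Exec (.assign x e) σ (Function.update σ x (e.eval σ)) (1 + e.cost σ)
  | seq {P Q : WProg} {σ₁ σ₂ σ₃ : Store} {t u : ℕ} :
      Exec P σ₁ σ₂ t → Exec Q σ₂ σ₃ u → Exec (.seq P Q) σ₁ σ₃ (1 + t + u)
  | cond_true {e : WExpr} {P Q : WProg} {σ₁ σ₂ : Store} {t : ℕ} :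
      e.eval σ₁ ≠ .int 0 → Exec P σ₁ σ₂ t → Exec (.cond e P Q) σ₁ σ₂ (1 + e.cost σ₁ + t)
  | cond_false {e : WExpr} {P Q : WProg} {σ₁ σ₂ : Store} {t : ℕ} :
      e.eval σ₁ = .int 0 → Exec Q σ₁ σ₂ t → Exec (.cond e P Q) σ₁ σ₂ (1 + e.cost σ₁ + t)
  | loop_true {e : WExpr} {P : WProg} {σ₁ σ₂ σ₃ : Store} {t u : ℕ} :
      e.eval σ₁ ≠ .int 0 → Exec P σ₁ σ₂ t → Exec (.loop e P) σ₂ σ₃ u →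
      Exec (.loop e P) σ₁ σ₃ (1 + e.cost σ₁ + t + u)
  | loop_false {e : WExpr} {P : WProg} {σ : Store} :
      e.eval σ = .int 0 → Exec (.loop e P) σ σ (1 + e.cost σ)

/-- On input `d` (in variable `0`, all other variables holding the leaf `0`), the program `P`
halts with cost `t` and output `d'` (in variable `0`). -/
def RunsTo (P : WProg) (d d' : Data) (t : ℕ) : Prop :=
  ∃ σ : Store, Exec P (Function.update (fun _ => .int 0) 0 d) σ t ∧ σ 0 = d'

/-! ### Coding of instances -/

/-- A number is coded by its numerator and denominator, a name by a leaf. -/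
def Value.code : Value → Data
  | .num q => .pair (.int q.num) (.int q.den)
  | .name n => .int n

/-- A row is coded by the list of its values. -/
def rowCode {S : Schema} {R : S.Rel} (t : Row S R) : Data :=
  .ofList (List.ofFn fun i => (t i).code)

/-- A listing of the rows of an instance, relation by relation. -/
abbrev Listing (S : Schema) : Type := (R : S.Rel) → List (Row S R)

/-- The listing contains each row of the instance exactly once, and no other rows. -/
def Listing.Lists {S : Schema} (L : Listing S) (D : Instance S) : Prop :=
  ∀ R, (L R).Nodup ∧ ∀ t, t ∈ L R ↔ t ∈ D.rows R

/-- A listing is coded by the list of its tables, each of which is the list of its rows. -/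
def Listing.code {S : Schema} (L : Listing S) : Data :=
  .ofList (List.ofFn fun R => .ofList ((L R).map rowCode))

end DBFix

open DBFix

/-!
# Constant factor approximation of least squares fixes

Let `M` exceed all constants in `IC` in absolute value. By one-sidedness, every fixable attribute
`A` has a direction in which all comparisons at `A` become false, and the algorithm writes only one
value at `A`, its target `M` or `-M`. Since fixable values are integers, and since a value that
resolves a violation has to reach or pass a constant, moving to the target is at most `2 * M + 1`
times as far as any other move that resolves the same violation (`target_sub_sq_le`).

Up to a constant factor, it remains to choose a cheap set of fixable cells that contains, for every
violation in `D`, one of the cells compared in it. Every fix has to move such a cell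
(`exists_moved`). Conversely, moving the cells of such a set to their targets creates no new
violation, since joins and equations between variables involve rigid attributes only, and since no
comparison is true at a target (`satisfies_repaired`).

This is a minimum weight hitting set problem, whose edges are as long as the denials allow. The
local ratio method solves it up to a constant factor: for each edge in turn, all its entries are
paid the least weight that remains to be paid on one of them, and finally the fully paid elements
are taken (`exists_paid`, `sum_weight_paid_le`). The number of violations is polynomial in the size
of `D`, because the denials are fixed.

For the running time, functions between coded types that are computed by While programs of
polynomial cost (`PolyTime`) are shown to be closed under composition, pairing, case distinction,
and iteration with a decreasing potential that bounds the size of the state (`PolyTime.while`).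
Recursion on lists follows if each step adds to the accumulator an amount that is bounded
independently of the accumulator (`PolyTime.foldl`), and all steps of the algorithm have this form.
-/

namespace DBFix

/-! ### Sizes and costs -/

theorem eval_mono (p : Polynomial ℕ) : Monotone fun n => p.eval n := by
  intro a b h
  simp only [Polynomial.eval_eq_sum_range]
  gcongr

theorem Data.size_pos (d : Data) : 0 < d.size := by
  cases d <;> simp [Data.size]

theorem Data.size_fst_le (d : Data) : d.fst.size ≤ d.size := by
  cases d <;> simp [Data.size, Data.fst]; omega

theorem Data.size_snd_le (d : Data) : d.snd.size ≤ d.size := by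
  cases d <;> simp [Data.size, Data.snd]

theorem Data.size_int_le {m : ℤ} {k : ℕ} (h : m.natAbs < 2 ^ k) : (Data.int m).size ≤ 1 + k := by
  have := Nat.size_le.2 h
  simp only [Data.size]; omega

theorem Data.size_int_mono {a b : ℤ} (h : a.natAbs ≤ b.natAbs) :
    (Data.int a).size ≤ (Data.int b).size := by
  have := Nat.size_le_size h
  simp only [Data.size]; omega

theorem Data.size_int_add_le (a b : ℤ) :
    (Data.int (a + b)).size ≤ (Data.int a).size + (Data.int b).size := by
  have h : (a + b).natAbs < 2 ^ (a.natAbs.size + b.natAbs.size + 1) := by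
    have h1 := Nat.lt_size_self a.natAbs
    have h2 := Nat.lt_size_self b.natAbs
    have h3 : 2 ^ a.natAbs.size ≤ 2 ^ (a.natAbs.size + b.natAbs.size) :=
      Nat.pow_le_pow_right (by norm_num) (by omega)
    have h4 : 2 ^ b.natAbs.size ≤ 2 ^ (a.natAbs.size + b.natAbs.size) :=
      Nat.pow_le_pow_right (by norm_num) (by omega)
    have := Int.natAbs_add_le a b
    rw [pow_succ]; omega
  have := Data.size_int_le h
  simp only [Data.size] at *; omega

theorem Data.size_int_sub_le (a b : ℤ) :
    (Data.int (a - b)).size ≤ (Data.int a).size + (Data.int b).size := by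
  have := Data.size_int_add_le a (-b)
  simpa [Data.size, sub_eq_add_neg] using this

theorem Data.size_int_mul_le (a b : ℤ) :
    (Data.int (a * b)).size ≤ (Data.int a).size + (Data.int b).size := by
  have h : (a * b).natAbs < 2 ^ (a.natAbs.size + b.natAbs.size) := by
    rw [Int.natAbs_mul, pow_add]
    exact Nat.mul_lt_mul'' (Nat.lt_size_self _) (Nat.lt_size_self _)
  have := Data.size_int_le h
  simp only [Data.size] at *; omega

theorem WExpr.size_eval_le_cost (σ : Store) (e : WExpr) : (e.eval σ).size ≤ e.cost σ := by
  cases e <;> simp [WExpr.cost, add_assoc]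

/-- A run cannot store anything larger than its cost. -/
theorem Exec.size_le {P : WProg} {σ σ' : Store} {t : ℕ} (h : Exec P σ σ' t) :
    ∀ i, (σ' i).size ≤ max (σ i).size t := by
  induction h with
  | skip | loop_false => intro i; simp
  | assign σ x e =>
    intro i
    have := e.size_eval_le_cost σ
    by_cases hi : i = x
    · subst hi; simp; omega
    · simp [hi]
  | seq _ _ h1 h2 => intro i; have := h1 i; have := h2 i; omega
  | cond_true _ _ h | cond_false _ _ h => intro i; have := h i; omega
  | loop_true _ _ _ h1 h2 => intro i; have := h1 i; have := h2 i; omega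

/-! ### Functions computable in polynomial time -/

/-- Types whose elements are coded by trees. -/
class Coded (α : Type) where
  /-- the code of an element -/
  enc : α → Data

open DBFix.Coded (enc)

instance : Coded Data := ⟨id⟩
instance : Coded ℤ := ⟨.int⟩
instance : Coded ℕ := ⟨fun n => .int n⟩
instance : Coded Bool := ⟨fun b => .int (if b then 1 else 0)⟩
instance : Coded Value := ⟨Value.code⟩
instance {α β : Type} [Coded α] [Coded β] : Coded (α × β) := ⟨fun x => .pair (enc x.1) (enc x.2)⟩
instance {α : Type} [Coded α] : Coded (List α) := ⟨fun l => .ofList (l.map enc)⟩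
instance {α : Type} [Coded α] {p : α → Prop} : Coded {a // p a} := ⟨fun a => enc a.1⟩

section
variable {α β γ δ : Type} [Coded α] [Coded β] [Coded γ] [Coded δ]

/-- `f` is computed on codes by While programs whose cost is polynomial in the size of the input.
The program for the parameter `n` reads its input from the variable `n`, leaves its output there,
and may use all variables above `n` as scratch space, whatever they contain. The variables below
`n` are preserved, so that they can hold intermediate results when programs are combined. -/
def PolyTime (f : α → β) : Prop :=
  ∃ p : Polynomial ℕ, ∀ n : ℕ, ∃ P : WProg, ∀ (a : α) (σ : Store), σ n = enc a →
    ∃ (σ' : Store) (t : ℕ), Exec P σ σ' t ∧ σ' n = enc (f a) ∧ (∀ i < n, σ' i = σ i) ∧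
      t ≤ p.eval (enc a).size

theorem PolyTime.size_le {f : α → β} (hf : PolyTime f) :
    ∃ p : Polynomial ℕ, ∀ a, (enc (f a)).size ≤ p.eval (enc a).size := by
  obtain ⟨p, hp⟩ := hf
  obtain ⟨P, hP⟩ := hp 0
  refine ⟨p + .X, fun a => ?_⟩
  obtain ⟨σ', t, h, h0, -, ht⟩ := hP a (fun _ => enc a) rfl
  have := h.size_le 0
  rw [h0] at this
  simp only [Polynomial.eval_add, Polynomial.eval_X]; omega

/-- Only the codes matter. -/
theorem PolyTime.of_enc {f : α → β} {g : γ → δ} (hg : PolyTime g) (k : α → γ)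
    (hk : ∀ a, enc a = enc (k a)) (h : ∀ a, enc (f a) = enc (g (k a))) : PolyTime f := by
  obtain ⟨p, hp⟩ := hg
  refine ⟨p, fun n => ?_⟩
  obtain ⟨P, hP⟩ := hp n
  refine ⟨P, fun a σ hσ => ?_⟩
  obtain ⟨σ', t, h1, h2, h3, h4⟩ := hP (k a) σ (hσ.trans (hk a))
  exact ⟨σ', t, h1, h2.trans (h a).symm, h3, by rwa [hk a]⟩

/-- A function given by a single expression, whose cost has to be bounded. -/
theorem PolyTime.of_expr {f : α → β} (p : Polynomial ℕ) (e : ℕ → WExpr)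
    (h : ∀ n a σ, σ n = enc a →
      (e n).eval σ = enc (f a) ∧ (e n).cost σ ≤ p.eval (enc a).size) : PolyTime f := by
  refine ⟨1 + p, fun n => ⟨.assign n (e n), fun a σ hσ => ⟨_, _, .assign _ _ _, ?_, ?_, ?_⟩⟩⟩
  · simpa using (h n a σ hσ).1
  · intro i hi; simp [hi.ne]
  · simpa using (h n a σ hσ).2

theorem PolyTime.code : PolyTime (fun a : α => enc a) :=
  .of_expr .X .var fun n a σ hσ => by simp [WExpr.eval, WExpr.cost, hσ]; rfl

theorem PolyTime.id' : PolyTime (fun a : α => a) :=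
  .of_enc .code _ (fun _ => rfl) fun _ => rfl

theorem PolyTime.val {p : α → Prop} : PolyTime (fun a : {a // p a} => a.1) :=
  .of_enc (.id' (α := α)) (fun a => a.1) (fun _ => rfl) fun _ => rfl

theorem exists_expr (d : Data) : ∃ (e : WExpr) (k : ℕ), ∀ σ, e.eval σ = d ∧ e.cost σ ≤ k := by
  induction d with
  | int z => exact ⟨.const z, (Data.int z).size, fun σ => by simp [WExpr.eval, WExpr.cost]⟩
  | pair a b ha hb =>
    obtain ⟨e, k, he⟩ := ha
    obtain ⟨f, l, hf⟩ := hb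
    refine ⟨.pair e f, (Data.pair a b).size + k + l, fun σ => ?_⟩
    simp only [WExpr.eval, WExpr.cost, (he σ).1, (hf σ).1, true_and]
    have := (he σ).2
    have := (hf σ).2
    omega

theorem PolyTime.const (b : β) : PolyTime (fun _ : α => b) := by
  obtain ⟨e, k, h⟩ := exists_expr (enc b)
  exact .of_expr (.C k) (fun _ => e) fun n a σ _ => by simpa using h σ

theorem PolyTime.comp {g : β → γ} {f : α → β} (hg : PolyTime g) (hf : PolyTime f) :
    PolyTime (fun a => g (f a)) := by
  obtain ⟨s, hs⟩ := hf.size_le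
  obtain ⟨p, hp⟩ := hf
  obtain ⟨q, hq⟩ := hg
  refine ⟨1 + p + q.comp s, fun n => ?_⟩
  obtain ⟨P, hP⟩ := hp n
  obtain ⟨Q, hQ⟩ := hq n
  refine ⟨.seq P Q, fun a σ hσ => ?_⟩
  obtain ⟨σ₁, t, h1, h2, h3, h4⟩ := hP a σ hσ
  obtain ⟨σ₂, u, k1, k2, k3, k4⟩ := hQ (f a) σ₁ h2
  refine ⟨σ₂, _, .seq h1 k1, k2, fun i hi => (k3 i hi).trans (h3 i hi), ?_⟩
  have := eval_mono q (hs a)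
  simp only [Polynomial.eval_add, Polynomial.eval_one, Polynomial.eval_comp] at *
  omega

theorem PolyTime.pair {f : α → β} {g : α → γ} (hf : PolyTime f) (hg : PolyTime g) :
    PolyTime (fun a => (f a, g a)) := by
  obtain ⟨s, hs⟩ := hf.size_le
  obtain ⟨r, hr⟩ := hg.size_le
  obtain ⟨p, hp⟩ := hf
  obtain ⟨q, hq⟩ := hg
  refine ⟨8 + 2 * .X + p + q + 2 * s + 2 * r, fun n => ?_⟩
  obtain ⟨P, hP⟩ := hp (n + 1)
  obtain ⟨Q, hQ⟩ := hq (n + 2)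
  refine ⟨.seq (.assign (n + 1) (.var n)) (.seq P (.seq (.assign (n + 2) (.var n))
    (.seq Q (.assign n (.pair (.var (n + 1)) (.var (n + 2))))))), fun a σ hσ => ?_⟩
  obtain ⟨σ₁, t, h1, h2, h3, h4⟩ := hP a (Function.update σ (n + 1) (σ n)) (by simp [hσ])
  have e1 : σ₁ n = enc a := by rw [h3 n (by omega)]; simp [hσ]
  obtain ⟨σ₂, u, k1, k2, k3, k4⟩ := hQ a (Function.update σ₁ (n + 2) (σ₁ n)) (by simp [e1])
  have e2 : σ₂ (n + 1) = enc (f a) := by rw [k3 _ (by omega)]; simp [h2]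
  refine ⟨_, _, .seq (.assign _ _ _) (.seq h1 (.seq (.assign _ _ _) (.seq k1 (.assign _ _ _)))),
    ?_, ?_, ?_⟩
  · simp [WExpr.eval, e2, k2]; rfl
  · intro i hi
    have : i ≠ n := hi.ne
    have : i ≠ n + 1 := by omega
    have : i ≠ n + 2 := by omega
    simp only [Function.update_of_ne, ne_eq, *, not_false_eq_true]
    rw [k3 i (by omega), Function.update_of_ne (by omega), h3 i (by omega),
      Function.update_of_ne (by omega)]
  · have := hs a
    have := hr a
    simp only [WExpr.cost, WExpr.eval, e1, e2, k2, hσ, Data.size, Polynomial.eval_add,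
      Polynomial.eval_mul, Polynomial.eval_X, Polynomial.eval_ofNat]
    omega

theorem PolyTime.ite {c : α → Bool} {f g : α → β} (hc : PolyTime c) (hf : PolyTime f)
    (hg : PolyTime g) : PolyTime (fun a => if c a then f a else g a) := by
  obtain ⟨r, hr⟩ := hc
  obtain ⟨p, hp⟩ := hf
  obtain ⟨q, hq⟩ := hg
  refine ⟨10 + .X + r + p + q, fun n => ?_⟩
  obtain ⟨R, hR⟩ := hr (n + 1)
  obtain ⟨P, hP⟩ := hp n
  obtain ⟨Q, hQ⟩ := hq n
  refine ⟨.seq (.assign (n + 1) (.var n)) (.seq R (.cond (.var (n + 1)) P Q)), fun a σ hσ => ?_⟩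
  obtain ⟨σ₁, t, h1, h2, h3, h4⟩ := hR a (Function.update σ (n + 1) (σ n)) (by simp [hσ])
  have e1 : σ₁ n = enc a := by rw [h3 n (by omega)]; simp [hσ]
  have e2 : ∀ i < n, σ₁ i = σ i := fun i hi => by
    rw [h3 i (by omega), Function.update_of_ne (by omega)]
  have e3 : (enc (c a)).size ≤ 2 := by cases c a <;> simp [enc, Data.size]
  cases hca : c a with
  | true =>
    obtain ⟨σ₂, u, k1, k2, k3, k4⟩ := hP a σ₁ e1
    refine ⟨_, _, .seq (.assign _ _ _) (.seq h1 (.cond_true ?_ k1)), ?_, ?_, ?_⟩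
    · simp [WExpr.eval, h2, hca, enc]
    · simpa [hca] using k2
    · exact fun i hi => (k3 i hi).trans (e2 i hi)
    · simp only [WExpr.cost, WExpr.eval, h2, hσ, Polynomial.eval_add, Polynomial.eval_X,
        Polynomial.eval_ofNat]
      omega
  | false =>
    obtain ⟨σ₂, u, k1, k2, k3, k4⟩ := hQ a σ₁ e1
    refine ⟨_, _, .seq (.assign _ _ _) (.seq h1 (.cond_false ?_ k1)), ?_, ?_, ?_⟩
    · simp [WExpr.eval, h2, hca, enc]
    · simpa [hca] using k2
    · exact fun i hi => (k3 i hi).trans (e2 i hi)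
    · simp only [WExpr.cost, WExpr.eval, h2, hσ, Polynomial.eval_add, Polynomial.eval_X,
        Polynomial.eval_ofNat]
      omega

/-- Iteration. The potential `S` bounds the sizes of all intermediate states as well as the number
of rounds. -/
theorem PolyTime.while {c : α → Bool} {f : {a // c a = true} → α} {g : α → α} (hc : PolyTime c)
    (hf : PolyTime f) (hg : ∀ a, g a = if h : c a = true then g (f ⟨a, h⟩) else a)
    (S : α → ℕ) (hS : ∀ a, (enc a).size ≤ S a) (hSf : ∀ a h, S (f ⟨a, h⟩) < S a)
    (s : Polynomial ℕ) (hs : ∀ a, S a ≤ s.eval (enc a).size) : PolyTime g := by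
  obtain ⟨r, hr⟩ := hc
  obtain ⟨p, hp⟩ := hf
  -- a bound for one round in terms of the potential
  let b : Polynomial ℕ := 10 + .X + r + p
  refine ⟨b.comp s * (1 + s) + b.comp s, fun n => ?_⟩
  obtain ⟨R, hR⟩ := hr (n + 1)
  obtain ⟨P, hP⟩ := hp n
  -- the test is computed ahead of each round, as a loop tests an expression
  let test : WProg := .seq (.assign (n + 1) (.var n)) R
  have htest : ∀ a (σ : Store), σ n = enc a → ∃ σ' t, Exec test σ σ' t ∧ σ' n = enc a ∧
      σ' (n + 1) = enc (c a) ∧ (∀ i < n, σ' i = σ i) ∧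
      t ≤ 2 + (enc a).size + r.eval (enc a).size := by
    intro a σ hσ
    obtain ⟨σ₁, t, h1, h2, h3, h4⟩ := hR a (Function.update σ (n + 1) (σ n)) (by simp [hσ])
    refine ⟨σ₁, _, .seq (.assign _ _ _) h1, by rw [h3 n (by omega)]; simp [hσ], h2,
      fun i hi => by rw [h3 i (by omega), Function.update_of_ne (by omega)], ?_⟩
    simp only [WExpr.cost, WExpr.eval, hσ]
    omega
  have e3 : ∀ a, (enc (c a)).size ≤ 2 := fun a => by cases c a <;> simp [enc, Data.size]
  -- `k` decreases with the potential, while `N` bounds the potentials throughout the run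
  have key : ∀ N k a (σ : Store), S a ≤ k → k ≤ N → σ n = enc a → σ (n + 1) = enc (c a) →
      ∃ σ' t, Exec (.loop (.var (n + 1)) (.seq P test)) σ σ' t ∧ σ' n = enc (g a) ∧
        (∀ i < n, σ' i = σ i) ∧ t ≤ b.eval N * (1 + k) := by
    intro N k
    induction k with
    | zero =>
      intro a σ h
      have := (enc a).size_pos
      have := hS a
      omega
    | succ k ih =>
      intro a σ h1 h2 h3 h4
      cases hca : c a with
      | false =>
        refine ⟨σ, _, .loop_false (by simp [WExpr.eval, h4, hca, enc]), ?_, fun _ _ => rfl, ?_⟩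
        · rw [hg]; simp [hca, h3]
        · have := e3 a
          have : 10 ≤ b.eval N := by simp [b, add_assoc]
          simp only [WExpr.cost, WExpr.eval, h4]
          nlinarith
      | true =>
        obtain ⟨σ₁, t, k1, k2, k3, k4⟩ := hP ⟨a, hca⟩ σ h3
        obtain ⟨σ₂, u, l1, l2, l3, l4, l5⟩ := htest _ σ₁ k2
        have hlt := hSf a hca
        obtain ⟨σ₃, v, m1, m2, m3, m4⟩ := ih _ σ₂ (by omega) (by omega) l2 l3
        refine ⟨σ₃, _, .loop_true ?_ (.seq k1 l1) m1, ?_, ?_, ?_⟩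
        · simp [WExpr.eval, h4, hca, enc]
        · rw [hg a]; simpa [hca] using m2
        · intro i hi; rw [m3 i hi, l4 i hi, k3 i hi]
        · have a1 := e3 a
          have a2 := hS (f ⟨a, hca⟩)
          have a3 := eval_mono r (show (enc (f ⟨a, hca⟩)).size ≤ N by omega)
          have a4 := eval_mono p (show (enc a).size ≤ N by have := hS a; omega)
          have a5 : b.eval N = 10 + N + r.eval N + p.eval N := by simp [b]
          have a6 : t ≤ p.eval (enc a).size := k4
          have a7 : b.eval N * (1 + (k + 1)) = b.eval N * (1 + k) + b.eval N := by ring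
          simp only [WExpr.cost, WExpr.eval, h4] at *
          omega
  refine ⟨.seq test (.loop (.var (n + 1)) (.seq P test)), fun a σ hσ => ?_⟩
  obtain ⟨σ₁, t, h1, h2, h3, h4, h5⟩ := htest a σ hσ
  obtain ⟨σ₂, u, k1, k2, k3, k4⟩ := key (s.eval (enc a).size) (s.eval (enc a).size) a σ₁
    (hs a) le_rfl h2 h3
  refine ⟨σ₂, _, .seq h1 k1, k2, fun i hi => (k3 i hi).trans (h4 i hi), ?_⟩
  have a1 : (enc a).size ≤ s.eval (enc a).size := (hS a).trans (hs a)
  have a2 := eval_mono r a1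
  have a3 : b.eval (s.eval (enc a).size) = 10 + s.eval (enc a).size
    + r.eval (s.eval (enc a).size) + p.eval (s.eval (enc a).size) := by simp [b]
  simp only [Polynomial.eval_add, Polynomial.eval_mul, Polynomial.eval_one, Polynomial.eval_comp]
    at *
  omega

end

section
variable {α β γ δ : Type} [Coded α] [Coded β] [Coded γ] [Coded δ]

/-! ### Basic operations -/

theorem PolyTime.congr {f g : α → β} (hf : PolyTime f) (h : ∀ a, g a = f a) : PolyTime g :=
  funext h ▸ hf

/-- Replaces a decision procedure by another one for an equivalent condition, whatever the instances
of decidability. -/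
theorem PolyTime.ofIff {p : α → Prop} [DecidablePred p] {c : α → Bool} (hc : PolyTime c)
    (h : ∀ a, p a ↔ c a = true) : PolyTime (fun a => decide (p a)) :=
  hc.congr fun a => by simp [h]

theorem PolyTime.dataFst : PolyTime Data.fst :=
  .of_expr (2 * .X) (fun n => .fst (.var n)) fun n a σ hσ => by
    have := a.size_fst_le
    simp only [WExpr.eval, WExpr.cost, hσ, Polynomial.eval_mul, Polynomial.eval_ofNat,
      Polynomial.eval_X]
    exact ⟨rfl, by change a.fst.size + a.size ≤ 2 * a.size; omega⟩

theorem PolyTime.dataSnd : PolyTime Data.snd :=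
  .of_expr (2 * .X) (fun n => .snd (.var n)) fun n a σ hσ => by
    have := a.size_snd_le
    simp only [WExpr.eval, WExpr.cost, hσ, Polynomial.eval_mul, Polynomial.eval_ofNat,
      Polynomial.eval_X]
    exact ⟨rfl, by change a.snd.size + a.size ≤ 2 * a.size; omega⟩

/-- Whether a tree is a pair. -/
def Data.isPairB : Data → Bool
  | .int _ => false
  | .pair _ _ => true

theorem PolyTime.dataIsPair : PolyTime Data.isPairB :=
  .of_expr (2 + .X) (fun n => .isPair (.var n)) fun n a σ hσ => by
    have h : (WExpr.var n).eval σ = a := hσ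
    have h' : (WExpr.var n).isPair.eval σ = a.isPair := congrArg Data.isPair hσ
    simp only [WExpr.cost, h, h']
    cases a <;> simp [enc, Data.isPair, Data.isPairB, Data.size]

theorem PolyTime.dataToInt : PolyTime Data.toInt :=
  .of_expr (4 + 3 * .X) (fun n => .add (.var n) (.const 0)) fun n a σ hσ => by
    simp only [WExpr.eval, WExpr.cost, hσ]
    cases a <;> simp [enc, Data.toInt, Data.size] <;> omega

theorem PolyTime.fst {f : α → β × γ} (hf : PolyTime f) : PolyTime (fun a => (f a).1) :=
  .of_enc (PolyTime.comp .dataFst (.comp .code hf)) id (fun _ => rfl) fun _ => rfl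

theorem PolyTime.snd {f : α → β × γ} (hf : PolyTime f) : PolyTime (fun a => (f a).2) :=
  .of_enc (PolyTime.comp .dataSnd (.comp .code hf)) id (fun _ => rfl) fun _ => rfl

theorem PolyTime.intAdd {f g : α → ℤ} (hf : PolyTime f) (hg : PolyTime g) :
    PolyTime (fun a => f a + g a) := by
  refine PolyTime.comp (g := fun x : ℤ × ℤ => x.1 + x.2) ?_ (hf.pair hg)
  refine .of_expr (5 * .X) (fun n => .add (.fst (.var n)) (.snd (.var n))) fun n a σ hσ => ?_
  have := Data.size_int_add_le a.1 a.2
  simp [WExpr.eval, WExpr.cost, hσ, enc, Data.fst, Data.snd, Data.toInt, Data.size] at *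
  omega

theorem PolyTime.intSub {f g : α → ℤ} (hf : PolyTime f) (hg : PolyTime g) :
    PolyTime (fun a => f a - g a) := by
  refine PolyTime.comp (g := fun x : ℤ × ℤ => x.1 - x.2) ?_ (hf.pair hg)
  refine .of_expr (5 * .X) (fun n => .sub (.fst (.var n)) (.snd (.var n))) fun n a σ hσ => ?_
  have := Data.size_int_sub_le a.1 a.2
  simp [WExpr.eval, WExpr.cost, hσ, enc, Data.fst, Data.snd, Data.toInt, Data.size] at *
  omega

theorem PolyTime.intMul {f g : α → ℤ} (hf : PolyTime f) (hg : PolyTime g) :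
    PolyTime (fun a => f a * g a) := by
  refine PolyTime.comp (g := fun x : ℤ × ℤ => x.1 * x.2) ?_ (hf.pair hg)
  refine .of_expr (5 * .X) (fun n => .mul (.fst (.var n)) (.snd (.var n))) fun n a σ hσ => ?_
  have := Data.size_int_mul_le a.1 a.2
  simp [WExpr.eval, WExpr.cost, hσ, enc, Data.fst, Data.snd, Data.toInt, Data.size] at *
  omega

theorem PolyTime.intLe {f g : α → ℤ} (hf : PolyTime f) (hg : PolyTime g) :
    PolyTime (fun a => decide (f a ≤ g a)) := by
  refine PolyTime.comp (g := fun x : ℤ × ℤ => decide (x.1 ≤ x.2)) ?_ (hf.pair hg)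
  refine .of_expr (5 * .X) (fun n => .le (.fst (.var n)) (.snd (.var n))) fun n a σ hσ => ?_
  have : (Data.int (if a.1 ≤ a.2 then 1 else 0)).size ≤ 2 := by split_ifs <;> simp [Data.size]
  simp [WExpr.eval, WExpr.cost, hσ, enc, Data.fst, Data.snd, Data.toInt, Data.size] at *
  omega

theorem PolyTime.natCast {f : α → ℕ} (hf : PolyTime f) : PolyTime (fun a => (f a : ℤ)) :=
  .of_enc hf id (fun _ => rfl) fun _ => rfl

theorem PolyTime.of_natCast {f : α → ℕ} (hf : PolyTime fun a => (f a : ℤ)) : PolyTime f :=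
  .of_enc hf id (fun _ => rfl) fun _ => rfl

theorem PolyTime.natAdd {f g : α → ℕ} (hf : PolyTime f) (hg : PolyTime g) :
    PolyTime (fun a => f a + g a) :=
  .of_natCast <| (hf.natCast.intAdd hg.natCast).congr fun a => by push_cast; rfl

theorem PolyTime.natLe {f g : α → ℕ} (hf : PolyTime f) (hg : PolyTime g) :
    PolyTime (fun a => decide (f a ≤ g a)) :=
  (hf.natCast.intLe hg.natCast).congr fun a => by simp

theorem PolyTime.natSub {f g : α → ℕ} (hf : PolyTime f) (hg : PolyTime g) :
    PolyTime (fun a => f a - g a) :=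
  .of_natCast <| ((hf.natLe hg).ite (.const 0) (hf.natCast.intSub hg.natCast)).congr fun a => by
    by_cases h : f a ≤ g a
    · simp [h]
    · simp [h]; omega

theorem PolyTime.natMin {f g : α → ℕ} (hf : PolyTime f) (hg : PolyTime g) :
    PolyTime (fun a => min (f a) (g a)) :=
  ((hf.natLe hg).ite hf hg).congr fun a => by simp [min_def]

theorem PolyTime.and {c d : α → Bool} (hc : PolyTime c) (hd : PolyTime d) :
    PolyTime (fun a => c a && d a) :=
  (hc.ite hd (.const false)).congr fun a => by cases c a <;> rfl

theorem PolyTime.not {c : α → Bool} (hc : PolyTime c) : PolyTime (fun a => !c a) :=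
  (hc.ite (.const false) (.const true)).congr fun a => by cases c a <;> rfl

/-! ### Lists -/

theorem enc_cons (a : α) (l : List α) : enc (a :: l) = .pair (enc a) (enc l) := rfl

theorem enc_prod (x : α × β) : enc x = .pair (enc x.1) (enc x.2) := rfl

theorem PolyTime.cons {f : α → β} {l : α → List β} (hf : PolyTime f) (hl : PolyTime l) :
    PolyTime (fun a => f a :: l a) :=
  .of_enc (hf.pair hl) id (fun _ => rfl) fun _ => rfl

theorem PolyTime.isEmpty {l : α → List β} (hl : PolyTime l) :
    PolyTime (fun a => (l a).isEmpty) := by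
  refine (PolyTime.dataIsPair.comp (.comp .code hl)).not.congr fun a => ?_
  cases l a <;> rfl

theorem PolyTime.head {l : α → List β} (hl : PolyTime l) (h : ∀ a, l a ≠ []) :
    PolyTime (fun a => (l a).head (h a)) := by
  refine .of_enc (PolyTime.dataFst.comp (.comp .code hl)) id (fun _ => rfl) fun a => ?_
  obtain ⟨x, xs, hx⟩ := List.exists_cons_of_ne_nil (h a)
  simp only [hx, List.head_cons, id]; rfl

theorem PolyTime.tail {l : α → List β} (hl : PolyTime l) : PolyTime (fun a => (l a).tail) := by
  refine .of_enc (PolyTime.dataSnd.comp (.comp .code hl)) id (fun _ => rfl) fun a => ?_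
  simp only [id]
  cases l a <;> rfl

/-- Beyond the end of a list, the projections of its code yield the leaf `0`; hence the condition on
the default value. -/
theorem PolyTime.getD {l : α → List β} (hl : PolyTime l) (i : ℕ) {d : β} (hd : enc d = .int 0) :
    PolyTime (fun a => (l a).getD i d) := by
  induction i generalizing l with
  | zero =>
    refine .of_enc (PolyTime.dataFst.comp (.comp .code hl)) id (fun _ => rfl) fun a => ?_
    simp only [id]
    cases l a
    · exact hd
    · rfl
  | succ i ih => exact (ih hl.tail).congr fun a => by cases l a <;> rfl

/-- Lists of fixed length. -/
theorem PolyTime.mapConst {ι : Type} {f : ι → α → β} (xs : List ι)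
    (h : ∀ x ∈ xs, PolyTime (f x)) : PolyTime (fun a => xs.map (f · a)) := by
  induction xs with
  | nil => exact .const []
  | cons x xs ih => exact (h x (by simp)).cons (ih fun y hy => h y (by simp [hy]))

theorem PolyTime.ofFn {n : ℕ} {f : Fin n → α → β} (h : ∀ i, PolyTime (f i)) :
    PolyTime (fun a => List.ofFn (f · a)) :=
  (PolyTime.mapConst (List.finRange n) fun i _ => h i).congr fun _ => List.ofFn_eq_map

theorem PolyTime.allConst {ι : Type} {c : ι → α → Bool} (xs : List ι)
    (h : ∀ x ∈ xs, PolyTime (c x)) : PolyTime (fun a => xs.all (c · a)) := by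
  induction xs with
  | nil => exact .const true
  | cons x xs ih => exact (h x (by simp)).and (ih fun y hy => h y (by simp [hy]))

theorem length_le_size (l : List α) : l.length ≤ (enc l).size := by
  induction l with
  | nil => simp
  | cons a l ih => simp only [enc_cons, Data.size, List.length_cons]; omega

/-- Recursion on lists, provided that every step adds at most polynomially much to the size of the
accumulator. The increment must not depend on the accumulator. -/
theorem PolyTime.foldl {g : γ → α → β → β} {init : γ → β} {l : γ → List α}
    (hg : PolyTime fun x : γ × α × β => g x.1 x.2.1 x.2.2) (hi : PolyTime init)
    (hl : PolyTime l) (q : Polynomial ℕ)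
    (hq : ∀ c a b, (enc (g c a b)).size ≤ (enc b).size + q.eval ((enc c).size + (enc a).size)) :
    PolyTime (fun c => (l c).foldl (fun b a => g c a b) (init c)) := by
  suffices h : PolyTime fun s : γ × β × List α =>
      (s.1, s.2.2.foldl (fun b a => g s.1 a b) s.2.1, ([] : List α)) from
    (h.comp (PolyTime.id'.pair (hi.pair hl))).snd.fst
  have hne : ∀ s : {s : γ × β × List α // (!s.2.2.isEmpty) = true}, s.1.2.2 ≠ [] := by
    rintro ⟨⟨c, b, l⟩, hs⟩ rfl
    simp at hs
  have hv : PolyTime fun s : {s : γ × β × List α // (!s.2.2.isEmpty) = true} => s.1 := .val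
  -- the potential counts the increments that are still to come
  refine .while (c := fun s => !s.2.2.isEmpty)
    (f := fun s => (s.1.1, g s.1.1 (s.1.2.2.head (hne s)) s.1.2.1, s.1.2.2.tail))
    (S := fun s => (enc s).size + s.2.2.length * q.eval ((enc s.1).size + (enc s.2.2).size))
    (s := .X + .X * q)
    PolyTime.id'.snd.snd.isEmpty.not ?_ ?_ ?_ ?_ ?_
  · exact hv.fst.pair ((hg.comp (hv.fst.pair ((hv.snd.snd.head hne).pair hv.snd.fst))).pair
      hv.snd.snd.tail)
  · rintro ⟨c, b, _ | ⟨a, l⟩⟩ <;> simp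
  · intro s; simp
  · rintro ⟨c, b, _ | ⟨a, l⟩⟩ h
    · simp at h
    · have h1 := hq c a b
      simp only [List.head_cons, List.tail_cons, enc_prod, enc_cons, Data.size, List.length_cons]
      have h2 := eval_mono q (show (enc c).size + (enc a).size ≤
        (enc c).size + (1 + (enc a).size + (enc l).size) by omega)
      have h3 := Nat.mul_le_mul_left l.length (eval_mono q
        (show (enc c).size + (enc l).size ≤ (enc c).size + (1 + (enc a).size + (enc l).size)
          by omega))
      simp only at h2 h3
      rw [add_one_mul]
      omega
  · rintro ⟨c, b, l⟩
    have h1 := length_le_size l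
    simp only [enc_prod, Data.size, Polynomial.eval_add, Polynomial.eval_X, Polynomial.eval_mul]
    gcongr
    · omega
    · exact eval_mono q (by omega)

theorem PolyTime.reverse {l : α → List β} (hl : PolyTime l) :
    PolyTime (fun a => (l a).reverse) := by
  refine (PolyTime.foldl (g := fun _ a b => a :: b) ?_ (.const []) hl (1 + .X)
    fun c a b => ?_).congr fun a => ?_
  · exact PolyTime.id'.snd.fst.cons PolyTime.id'.snd.snd
  · simp [enc_cons, Data.size]; omega
  · simp [List.foldl_flip_cons_eq_append]

theorem PolyTime.foldr {g : γ → α → β → β} {init : γ → β} {l : γ → List α}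
    (hg : PolyTime fun x : γ × α × β => g x.1 x.2.1 x.2.2) (hi : PolyTime init)
    (hl : PolyTime l) (q : Polynomial ℕ)
    (hq : ∀ c a b, (enc (g c a b)).size ≤ (enc b).size + q.eval ((enc c).size + (enc a).size)) :
    PolyTime (fun c => (l c).foldr (g c) (init c)) :=
  (PolyTime.foldl hg hi hl.reverse q hq).congr fun c => by rw [List.foldl_reverse]

theorem PolyTime.append {l m : α → List β} (hl : PolyTime l) (hm : PolyTime m) :
    PolyTime (fun a => l a ++ m a) := by
  refine (PolyTime.foldr (g := fun _ a b => a :: b) ?_ hm hl (1 + .X)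
    fun c a b => ?_).congr fun a => ?_
  · exact PolyTime.id'.snd.fst.cons PolyTime.id'.snd.snd
  · simp [enc_cons, Data.size]; omega
  · simp

theorem size_append_le (l m : List α) : (enc (l ++ m)).size ≤ (enc l).size + (enc m).size := by
  induction l with
  | nil => simp
  | cons a l ih => simp only [List.cons_append, enc_cons, Data.size]; omega

theorem PolyTime.flatMap {l : γ → List α} {f : γ → α → List β} (hl : PolyTime l)
    (hf : PolyTime fun x : γ × α => f x.1 x.2) : PolyTime (fun c => (l c).flatMap (f c)) := by
  obtain ⟨p, hp⟩ := hf.size_le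
  refine (PolyTime.foldr (g := fun c a b => f c a ++ b) ?_ (.const []) hl (p.comp (1 + .X))
    fun c a b => ?_).congr fun c => ?_
  · exact (hf.comp (PolyTime.id'.fst.pair PolyTime.id'.snd.fst)).append PolyTime.id'.snd.snd
  · have h1 := size_append_le (f c a) b
    have h2 := hp (c, a)
    simp only [enc_prod, Data.size] at h2
    simp only [Polynomial.eval_comp, Polynomial.eval_add, Polynomial.eval_one, Polynomial.eval_X]
    rw [← add_assoc]
    omega
  · induction l c <;> simp_all

theorem PolyTime.map {l : γ → List α} {f : γ → α → β} (hl : PolyTime l)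
    (hf : PolyTime fun x : γ × α => f x.1 x.2) : PolyTime (fun c => (l c).map (f c)) :=
  (PolyTime.flatMap (f := fun c a => [f c a]) hl (hf.cons (.const []))).congr fun c => by
    induction l c <;> simp_all

theorem PolyTime.filter {l : γ → List α} {f : γ → α → Bool} (hl : PolyTime l)
    (hf : PolyTime fun x : γ × α => f x.1 x.2) : PolyTime (fun c => (l c).filter (f c)) := by
  refine (PolyTime.flatMap (f := fun c a => if f c a then [a] else []) hl
    (hf.ite (PolyTime.id'.snd.cons (.const [])) (.const []))).congr fun c => ?_
  induction l c with
  | nil => rfl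
  | cons a l ih => by_cases h : f c a <;> simp_all

theorem PolyTime.sum {l : α → List ℕ} (hl : PolyTime l) : PolyTime (fun a => (l a).sum) := by
  refine (PolyTime.foldr (g := fun _ a b => a + b) ?_ (.const 0) hl .X fun c a b => ?_).congr
    fun _ => rfl
  · exact PolyTime.id'.snd.fst.natAdd PolyTime.id'.snd.snd
  · have := Data.size_int_add_le a b
    simp [enc, Data.size] at *
    omega

/-! ### Equality of codes -/

open Classical in
theorem PolyTime.dataEq : PolyTime (fun x : Data × Data => decide (x.1 = x.2)) := by
  -- The state consists of the pairs that remain to be compared, and the result so far. Sizes count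
  -- twice in the potential, as a comparison may replace a pair of trees by two pairs of subtrees.
  suffices h : PolyTime fun s : List (Data × Data) × Bool =>
      (([] : List (Data × Data)), s.2 && decide (∀ x ∈ s.1, x.1 = x.2)) from
    (h.comp ((PolyTime.id'.cons (.const [])).pair (.const true))).snd.congr fun x => by simp
  have hne : ∀ s : {s : List (Data × Data) × Bool // (!s.1.isEmpty) = true}, s.1.1 ≠ [] := by
    rintro ⟨⟨l, b⟩, hs⟩ rfl
    simp at hs
  have hv : PolyTime fun s : {s : List (Data × Data) × Bool // (!s.1.isEmpty) = true} => s.1 :=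
    .val
  have hd := hv.fst.head hne
  refine .while (c := fun s => !s.1.isEmpty)
    (f := fun s =>
      if (s.1.1.head (hne s)).1.isPairB && (s.1.1.head (hne s)).2.isPairB then
        (((s.1.1.head (hne s)).1.fst, (s.1.1.head (hne s)).2.fst) ::
          ((s.1.1.head (hne s)).1.snd, (s.1.1.head (hne s)).2.snd) :: s.1.1.tail, s.1.2)
      else (s.1.1.tail, s.1.2 && (!(s.1.1.head (hne s)).1.isPairB &&
        (!(s.1.1.head (hne s)).2.isPairB &&
        (decide ((s.1.1.head (hne s)).1.toInt ≤ (s.1.1.head (hne s)).2.toInt) &&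
        decide ((s.1.1.head (hne s)).2.toInt ≤ (s.1.1.head (hne s)).1.toInt))))))
    (S := fun s => 4 + (s.1.map fun x => 2 * x.1.size + 2 * x.2.size).sum)
    (s := 4 + 2 * .X) PolyTime.id'.fst.isEmpty.not ?_ ?_ ?_ ?_ ?_
  · refine .ite ((dataIsPair.comp hd.fst).and (dataIsPair.comp hd.snd)) ?_ ?_
    · exact (((dataFst.comp hd.fst).pair (dataFst.comp hd.snd)).cons
        (((dataSnd.comp hd.fst).pair (dataSnd.comp hd.snd)).cons hv.fst.tail)).pair hv.snd
    · exact hv.fst.tail.pair (hv.snd.and ((dataIsPair.comp hd.fst).not.and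
        ((dataIsPair.comp hd.snd).not.and
          (((dataToInt.comp hd.fst).intLe (dataToInt.comp hd.snd)).and
            ((dataToInt.comp hd.snd).intLe (dataToInt.comp hd.fst))))))
  · rintro ⟨_ | ⟨⟨x | ⟨x, x'⟩, y | ⟨y, y'⟩⟩, l⟩, b⟩
    · simp
    · simp [Data.isPairB, Data.toInt, le_antisymm_iff (α := ℤ), Bool.and_assoc]
      congr!
    · simp [Data.isPairB]
    · simp [Data.isPairB]
    · simp [Data.isPairB, Data.fst, Data.snd, and_assoc]
  · rintro ⟨l, b⟩
    have hb : (enc b).size ≤ 2 := by cases b <;> simp [enc, Data.size]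
    have : (enc l).size ≤ 1 + (l.map fun x => 2 * x.1.size + 2 * x.2.size).sum := by
      induction l with
      | nil => simp [enc, Data.ofList, Data.size]
      | cons x l ih =>
        have h1 := x.1.size_pos
        have h2 := x.2.size_pos
        simp only [enc_cons, enc_prod, Data.size, List.map_cons, List.sum_cons]
        change 1 + (1 + x.1.size + x.2.size) + _ ≤ _
        omega
    simp only [enc_prod, Data.size]
    omega
  · rintro ⟨_ | ⟨⟨x, y⟩, l⟩, b⟩ h
    · simp at h
    · have h1 := x.size_pos
      have h2 := y.size_pos
      cases x <;> cases y <;> simp [Data.isPairB, Data.fst, Data.snd, Data.size] at * <;> omega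
  · rintro ⟨l, b⟩
    have : (l.map fun x => 2 * x.1.size + 2 * x.2.size).sum ≤ 2 * (enc l).size := by
      induction l with
      | nil => simp
      | cons x l ih =>
        simp only [enc_cons, enc_prod, Data.size, List.map_cons, List.sum_cons]
        change _ ≤ 2 * (1 + (1 + x.1.size + x.2.size) + _)
        omega
    simp only [enc_prod, Data.size, Polynomial.eval_add, Polynomial.eval_mul,
      Polynomial.eval_ofNat, Polynomial.eval_X]
    omega

theorem PolyTime.eq [DecidableEq β] (hinj : Function.Injective (enc : β → Data)) {f g : α → β}
    (hf : PolyTime f) (hg : PolyTime g) : PolyTime (fun a => decide (f a = g a)) :=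
  (PolyTime.dataEq.comp ((PolyTime.code.comp hf).pair (PolyTime.code.comp hg))).congr fun a => by
    simp [hinj.eq_iff]

theorem enc_injective_nat : Function.Injective (enc : ℕ → Data) := fun a b h => by
  simpa [enc] using h

theorem enc_injective_value : Function.Injective (enc : Value → Data) := by
  rintro (a | a) (b | b) h
  · simp only [enc, Value.code, Data.pair.injEq, Data.int.injEq, Nat.cast_inj] at h
    rw [Rat.ext h.1 h.2]
  · simp [enc, Value.code] at h
  · simp [enc, Value.code] at h
  · simpa [enc, Value.code] using h

theorem enc_injective_prod (hα : Function.Injective (enc : α → Data))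
    (hβ : Function.Injective (enc : β → Data)) : Function.Injective (enc : α × β → Data) := by
  rintro ⟨a, b⟩ ⟨a', b'⟩ h
  simp only [enc_prod, Data.pair.injEq] at h
  rw [hα h.1, hβ h.2]

theorem enc_injective_list (hα : Function.Injective (enc : α → Data)) :
    Function.Injective (enc : List α → Data) := by
  intro l
  induction l with
  | nil => rintro (_ | ⟨b, m⟩) h <;> simp_all [enc, Data.ofList]
  | cons a l ih =>
    rintro (_ | ⟨b, m⟩) h
    · simp [enc, Data.ofList] at h
    · simp only [enc_cons, Data.pair.injEq] at h
      rw [hα h.1, ih h.2]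

end

/-! ### Approximate minimum weight hitting sets -/

section
variable {α : Type}

open Classical in
/-- The total amount that the payments `y` assign to the element `e`. -/
noncomputable def paid (y : List (α × ℕ)) (e : α) : ℕ :=
  (y.map fun x => if x.1 = e then x.2 else 0).sum

/-- The least weight that remains to be paid on an element of `E`; the sum of all weights serves
as a start value for the minimum. -/
noncomputable def slack (w : α → ℕ) (y : List (α × ℕ)) (E : List α) : ℕ :=
  E.foldr (fun e m => min (w e - paid y e) m) (E.map w).sum

/-- One step of the local ratio algorithm: all entries of `E` are paid the least weight that remains
to be paid on one of them. -/
noncomputable def payStep (w : α → ℕ) (y : List (α × ℕ)) (E : List α) : List (α × ℕ) :=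
  y ++ E.map fun e => (e, slack w y E)

/-- The payments of the local ratio algorithm for the hypergraph with edges `Es`. -/
noncomputable def payments (w : α → ℕ) (Es : List (List α)) : List (α × ℕ) :=
  Es.foldl (payStep w) []

theorem paid_cons [DecidableEq α] (x : α × ℕ) (y : List (α × ℕ)) (e : α) :
    paid (x :: y) e = (if x.1 = e then x.2 else 0) + paid y e := by
  simp only [paid, List.map_cons, List.sum_cons]
  congr!

theorem paid_append (y z : List (α × ℕ)) (e : α) : paid (y ++ z) e = paid y e + paid z e := by
  simp [paid]

theorem paid_map_le (E : List α) (d : ℕ) (e : α) :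
    paid (E.map fun a => (a, d)) e ≤ E.length * d := by
  classical
  induction E with
  | nil => simp [paid]
  | cons a E ih =>
    simp only [List.map_cons, paid_cons, List.length_cons, add_one_mul]
    split_ifs <;> omega

theorem paid_map_of_notMem {E : List α} {e : α} (d : ℕ) (h : e ∉ E) :
    paid (E.map fun a => (a, d)) e = 0 := by
  classical
  induction E with
  | nil => simp [paid]
  | cons a E ih =>
    simp only [List.mem_cons, not_or] at h
    simp [paid_cons, ih h.2, Ne.symm h.1]

theorem le_paid_map {E : List α} {e : α} (d : ℕ) (h : e ∈ E) :
    d ≤ paid (E.map fun a => (a, d)) e := by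
  classical
  induction E with
  | nil => simp at h
  | cons a E ih =>
    simp only [List.map_cons, paid_cons]
    rcases List.mem_cons.1 h with rfl | h
    · simp
    · have := ih h; omega

theorem sum_paid_le (y : List (α × ℕ)) (U : Finset α) :
    ∑ e ∈ U, paid y e ≤ (y.map Prod.snd).sum := by
  classical
  induction y with
  | nil => simp [paid]
  | cons x y ih =>
    simp only [paid_cons, Finset.sum_add_distrib, Finset.sum_ite_eq, List.map_cons,
      List.sum_cons]
    split_ifs <;> omega

theorem slack_le (w : α → ℕ) (y : List (α × ℕ)) {E : List α} {e : α} (h : e ∈ E) :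
    slack w y E ≤ w e - paid y e := by
  unfold slack
  generalize (E.map w).sum = b
  induction E with
  | nil => simp at h
  | cons a E ih =>
    rcases List.mem_cons.1 h with rfl | h
    · exact min_le_left _ _
    · exact (min_le_right _ _).trans (ih h)

theorem slack_le_sum (w : α → ℕ) (y : List (α × ℕ)) (E : List α) :
    slack w y E ≤ (E.map w).sum := by
  unfold slack
  generalize (E.map w).sum = b
  induction E with
  | nil => simp
  | cons a E ih => exact (min_le_right _ _).trans ih

theorem exists_le_slack (w : α → ℕ) (y : List (α × ℕ)) {E : List α} (h : E ≠ []) :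
    ∃ e ∈ E, w e - paid y e ≤ slack w y E := by
  have key : ∀ (F : List α) (b : ℕ),
      (∃ e ∈ F, w e - paid y e ≤ F.foldr (fun e m => min (w e - paid y e) m) b) ∨
        F.foldr (fun e m => min (w e - paid y e) m) b = b := by
    intro F b
    induction F with
    | nil => simp
    | cons a F ih =>
      simp only [List.foldr_cons, List.mem_cons, exists_eq_or_imp]
      rcases ih with ⟨e, he, h⟩ | h
      · rcases min_choice (w a - paid y a) (F.foldr (fun e m => min (w e - paid y e) m) b) with
          h' | h' <;> rw [h']
        · exact .inl (.inl le_rfl)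
        · exact .inl (.inr ⟨e, he, h⟩)
      · rw [h]
        rcases min_choice (w a - paid y a) b with h' | h' <;> rw [h']
        · exact .inl (.inl le_rfl)
        · exact .inr rfl
  rcases key E (E.map w).sum with h' | h'
  · exact h'
  · obtain ⟨e, he⟩ := List.exists_mem_of_ne_nil E h
    refine ⟨e, he, ?_⟩
    have := List.single_le_sum (fun _ _ => Nat.zero_le _) (w e) (List.mem_map_of_mem (f := w) he)
    rw [slack, h']
    omega

theorem payments_concat (w : α → ℕ) (Es : List (List α)) (E : List α) :
    payments w (Es ++ [E]) = payStep w (payments w Es) E := by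
  simp [payments]

/-- The elements that are fully paid form a hitting set. -/
theorem exists_paid (w : α → ℕ) (Es : List (List α)) :
    ∀ E ∈ Es, E ≠ [] → ∃ e ∈ E, w e ≤ paid (payments w Es) e := by
  induction Es using List.reverseRecOn with
  | nil => simp
  | append_singleton Es F ih =>
    intro E hE hne
    simp only [payments_concat, payStep, paid_append]
    rcases List.mem_append.1 hE with h | h
    · obtain ⟨e, he, h⟩ := ih E h hne
      exact ⟨e, he, by omega⟩
    · obtain rfl : E = F := by simpa using h
      obtain ⟨e, he, h⟩ := exists_le_slack w (payments w Es) hne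
      have := le_paid_map (slack w (payments w Es) E) he
      exact ⟨e, he, by omega⟩

/-- Repetitions of an element in an edge are possible, hence the factor `f`. -/
theorem paid_payments_le (w : α → ℕ) {f : ℕ} (hf : 1 ≤ f) {Es : List (List α)}
    (hEs : ∀ E ∈ Es, E.length ≤ f) (e : α) : paid (payments w Es) e ≤ f * w e := by
  induction Es using List.reverseRecOn with
  | nil => simp [payments, paid]
  | append_singleton Es E ih =>
    have ih := ih fun F hF => hEs F (by simp [hF])
    simp only [payments_concat, payStep, paid_append]
    by_cases he : e ∈ E
    · have h1 := slack_le w (payments w Es) he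
      have h2 := paid_map_le E (slack w (payments w Es) E) e
      have h3 := Nat.mul_le_mul (hEs E (by simp)) h1
      rcases le_total (w e) (paid (payments w Es) e) with h | h
      · rw [Nat.sub_eq_zero_of_le h] at h3
        omega
      · obtain ⟨k, hk⟩ := Nat.exists_eq_add_of_le h
        rw [hk, Nat.add_sub_cancel_left] at h3
        rw [hk]
        nlinarith
    · rw [paid_map_of_notMem _ he]
      simpa using ih

/-- Every step pays the same amount to at most `f` elements, one of which lies in `H`. -/
theorem total_payments_le (w : α → ℕ) {f : ℕ} {Es : List (List α)}
    (hEs : ∀ E ∈ Es, E.length ≤ f) (H : Finset α) (hH : ∀ E ∈ Es, ∃ e ∈ E, e ∈ H) :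
    ((payments w Es).map Prod.snd).sum ≤ f * ∑ e ∈ H, paid (payments w Es) e := by
  induction Es using List.reverseRecOn with
  | nil => simp [payments]
  | append_singleton Es E ih =>
    have ih := ih (fun F hF => hEs F (by simp [hF])) (fun F hF => hH F (by simp [hF]))
    obtain ⟨e, he, heH⟩ := hH E (by simp)
    have h1 := (le_paid_map (slack w (payments w Es) E) he).trans <|
      Finset.single_le_sum (f := fun e => paid (E.map fun a => (a, slack w (payments w Es) E)) e)
        (fun _ _ => Nat.zero_le _) heH
    have h2 := Nat.mul_le_mul (hEs E (by simp)) h1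
    simp only [payments_concat, payStep, paid_append, Finset.sum_add_distrib, List.map_append,
      List.sum_append, List.map_map, mul_add]
    have h3 : (E.map (Prod.snd ∘ fun a => (a, slack w (payments w Es) E))).sum
        = E.length * slack w (payments w Es) E := by
      simp [Function.comp_def]
    omega

/-- The local ratio bound: the fully paid elements weigh at most `f ^ 2` times as much as any
hitting set `H`, if no edge has more than `f` elements. -/
theorem sum_weight_paid_le (w : α → ℕ) {f : ℕ} (hf : 1 ≤ f) {Es : List (List α)}
    (hEs : ∀ E ∈ Es, E.length ≤ f) (H : Finset α) (hH : ∀ E ∈ Es, ∃ e ∈ E, e ∈ H)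
    (U : Finset α) (hU : ∀ e ∈ U, w e ≤ paid (payments w Es) e) :
    ∑ e ∈ U, w e ≤ f ^ 2 * ∑ e ∈ H, w e :=
  calc ∑ e ∈ U, w e ≤ ∑ e ∈ U, paid (payments w Es) e := Finset.sum_le_sum hU
    _ ≤ ((payments w Es).map Prod.snd).sum := sum_paid_le _ _
    _ ≤ f * ∑ e ∈ H, paid (payments w Es) e := total_payments_le w hEs H hH
    _ ≤ f * ∑ e ∈ H, f * w e := by gcongr; exact paid_payments_le w hf hEs _
    _ = f ^ 2 * ∑ e ∈ H, w e := by rw [← Finset.mul_sum]; ring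

theorem size_nat_mono {a b : ℕ} (h : a ≤ b) : (enc a).size ≤ (enc b).size :=
  Data.size_int_mono (by simpa using h)

variable [Coded α] {γ : Type} [Coded γ]

theorem PolyTime.paid (hinj : Function.Injective (enc : α → Data)) {y : γ → List (α × ℕ)}
    {e : γ → α} (hy : PolyTime y) (he : PolyTime e) : PolyTime (fun c => paid (y c) (e c)) := by
  classical
  refine (PolyTime.sum <| PolyTime.map
    (f := fun c x => if decide (x.1 = e c) then x.2 else 0) hy ?_).congr fun c => ?_
  · exact .ite (.eq hinj PolyTime.id'.snd.fst (he.comp PolyTime.id'.fst)) PolyTime.id'.snd.snd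
      (.const 0)
  · simp only [decide_eq_true_eq, DBFix.paid]

theorem PolyTime.slack (hinj : Function.Injective (enc : α → Data)) {w : α → ℕ}
    (hw : PolyTime w) : PolyTime (fun c : List α × List (α × ℕ) => slack w c.2 c.1) := by
  refine PolyTime.foldr (γ := List α × List (α × ℕ))
    (g := fun c e m => min (w e - DBFix.paid c.2 e) m) ?_ ?_ PolyTime.id'.fst 0 fun c a b => ?_
  · exact ((hw.comp PolyTime.id'.snd.fst).natSub
      (.paid hinj PolyTime.id'.fst.snd PolyTime.id'.snd.fst)).natMin PolyTime.id'.snd.snd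
  · exact .sum (PolyTime.id'.fst.map (hw.comp PolyTime.id'.snd))
  · simp only [Polynomial.eval_zero, add_zero]
    exact size_nat_mono (min_le_right _ _)

theorem PolyTime.payments (hinj : Function.Injective (enc : α → Data)) {w : α → ℕ}
    (hw : PolyTime w) : PolyTime (payments w) := by
  have hsum : PolyTime fun E : List α => (E.map w).sum :=
    .sum (PolyTime.id'.map (hw.comp PolyTime.id'.snd))
  obtain ⟨p, hp⟩ := hsum.size_le
  refine PolyTime.foldl (γ := List (List α)) (g := fun _ E y => payStep w y E) ?_ (.const [])
    PolyTime.id' ((.X + .X * (1 + p)) : Polynomial ℕ) fun c E y => ?_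
  · exact PolyTime.id'.snd.snd.append (PolyTime.map PolyTime.id'.snd.fst
      (PolyTime.id'.snd.pair ((PolyTime.slack hinj hw).comp PolyTime.id'.fst.snd)))
  · have h1 := size_append_le y (E.map fun e => (e, DBFix.slack w y E))
    have h2 : (enc (DBFix.slack w y E)).size ≤ p.eval (enc E).size :=
      (size_nat_mono (slack_le_sum w y E)).trans (hp E)
    have h3 : ∀ (F : List α) (d : ℕ), (enc (F.map fun e => (e, d))).size ≤
        (enc F).size + F.length * (1 + (enc d).size) := by
      intro F d
      induction F with
      | nil => simp [enc]
      | cons a F ih =>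
        simp only [List.map_cons, enc_cons, enc_prod, Data.size, List.length_cons, add_one_mul]
        omega
    refine h1.trans (Nat.add_le_add_left ((h3 _ _).trans ?_) _)
    have h4 := length_le_size E
    have h5 := eval_mono p (Nat.le_add_left (enc E).size (enc c).size)
    simp only [Polynomial.eval_add, Polynomial.eval_X, Polynomial.eval_mul, Polynomial.eval_one]
    refine Nat.add_le_add (by omega) (Nat.mul_le_mul (by omega) ?_)
    simp only at h5
    omega

end

/-! ### Violations of a denial -/

section
variable {γ : Type} [Coded γ]

/-- The tables of a database, as lists of lists of values. -/
abbrev Tables : Type := List (List (List Value))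

/-- The choices of one row from each of the tables with the given numbers. -/
def tuples (db : Tables) : List ℕ → List (List (List Value))
  | [] => [[]]
  | R :: Rs => (db.getD R []).flatMap fun r => (tuples db Rs).map fun rs => r :: rs

theorem PolyTime.tuples (Rs : List ℕ) : PolyTime fun db => tuples db Rs := by
  induction Rs with
  | nil => exact .const _
  | cons R Rs ih =>
    exact .flatMap (PolyTime.id'.getD R rfl)
      (.map (ih.comp PolyTime.id'.fst) (PolyTime.id'.fst.snd.cons PolyTime.id'.snd))

/-- The tables in a listing. -/
def Listing.tables {S : Schema} (L : Listing S) : Tables :=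
  List.ofFn fun R => (L R).map fun t => List.ofFn t

theorem enc_row {S : Schema} {R : S.Rel} (t : Row S R) : enc (List.ofFn t) = rowCode t := by
  simp only [enc, rowCode, List.map_ofFn]; rfl

theorem Listing.enc_tables {S : Schema} (L : Listing S) : enc L.tables = L.code := by
  simp only [Listing.tables, Listing.code]
  change Data.ofList (List.map enc _) = _
  rw [List.map_ofFn]
  congr 2
  funext R
  simp only [Function.comp_apply]
  change Data.ofList (List.map enc _) = _
  rw [List.map_map]
  congr 2
  funext t
  exact enc_row t

theorem Listing.getD_tables {S : Schema} (L : Listing S) (R : S.Rel) :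
    L.tables.getD R [] = (L R).map fun t => List.ofFn t := by
  simp [Listing.tables]

theorem mem_tuples {S : Schema} (L : Listing S) (as : List (DBAtom S)) (τ : List (List Value)) :
    τ ∈ tuples L.tables (as.map fun a => (a.rel : ℕ)) ↔
      ∃ t : (j : Fin as.length) → Row S (as.get j).rel,
        (∀ j, t j ∈ L _) ∧ τ = List.ofFn fun j => List.ofFn (t j) := by
  induction as generalizing τ with
  | nil =>
    simp only [List.map_nil, tuples, List.mem_singleton]
    exact ⟨fun h => ⟨fun j => j.elim0, fun j => j.elim0, by simpa using h⟩,
      fun ⟨_, _, h⟩ => by simpa using h⟩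
  | cons a as ih =>
    simp only [List.map_cons, tuples, Listing.getD_tables, List.mem_flatMap, List.mem_map]
    constructor
    · rintro ⟨_, ⟨t₀, h₀, rfl⟩, τ', hτ', rfl⟩
      obtain ⟨t, ht, rfl⟩ := (ih τ').1 hτ'
      refine ⟨Fin.cases t₀ t, Fin.cases h₀ ht, ?_⟩
      simp only [List.length_cons, List.ofFn_succ]
      rfl
    · rintro ⟨t, ht, rfl⟩
      refine ⟨_, ⟨t 0, ht 0, rfl⟩, _,
        (ih (List.ofFn fun j => List.ofFn (t j.succ))).2
          ⟨fun j => t j.succ, fun j => ht j.succ, rfl⟩, ?_⟩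
      simp only [List.length_cons, List.ofFn_succ]
      rfl

/-- The value at an argument position, when rows are assigned to the atoms. The default values are
never used for rows of the right lengths; they are those for which `PolyTime.getD` applies. -/
def Pos.value {S : Schema} {as : List (DBAtom S)} (p : Pos as) (τ : List (List Value)) : Value :=
  (τ.getD p.1 []).getD p.2 (.name 0)

theorem Pos.value_ofFn {S : Schema} {as : List (DBAtom S)} (p : Pos as)
    (t : (j : Fin as.length) → Row S (as.get j).rel) :
    p.value (List.ofFn fun j => List.ofFn (t j)) = t p.1 p.2 := by
  obtain ⟨j, i⟩ := p
  simp [Pos.value]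

open Classical in
/-- The valuation that is read off from rows assigned to the atoms, each variable being read at
one of its positions. -/
noncomputable def valuation {S : Schema} (as : List (DBAtom S)) (τ : List (List Value)) (x : ℕ) :
    Value :=
  if h : ∃ p : Pos as, p.var = x then h.choose.value τ else .name 0

theorem valuation_var {S : Schema} {as : List (DBAtom S)} {τ : List (List Value)}
    (h : ∀ p q : Pos as, p.var = q.var → p.value τ = q.value τ) (p : Pos as) :
    valuation as τ p.var = p.value τ := by
  have hp : ∃ q : Pos as, q.var = p.var := ⟨p, rfl⟩
  rw [valuation, dif_pos hp]
  exact h _ _ hp.choose_spec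

/-- The rows `τ`, taken for the database atoms of `ic`, violate the denial `ic`. -/
def IsViolation {S : Schema} (ic : LinearDenial S) (τ : List (List Value)) : Prop :=
  (∀ p : Pos ic.atoms, p.value τ = valuation ic.atoms τ p.var) ∧
    ∀ b ∈ ic.builtIns, b.Holds (valuation ic.atoms τ)

theorem PolyTime.toRatNum {f : γ → Value} (hf : PolyTime f) :
    PolyTime fun c => (f c).toRat.num :=
  (dataToInt.comp (dataFst.comp (.comp .code hf))).congr fun c => by
    cases f c <;> simp [Value.toRat, enc, Value.code, Data.fst, Data.toInt]

theorem CmpOp.holds_eq (v c : Value) : CmpOp.eq.Holds v c ↔ v = c := by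
  cases v <;> cases c <;> simp [CmpOp.Holds]

theorem CmpOp.holds_ne (v c : Value) : CmpOp.ne.Holds v c ↔ v ≠ c := by
  cases v <;> cases c <;> simp [CmpOp.Holds]

open Classical in
theorem PolyTime.holds (θ : CmpOp) (v : Value) {f : γ → Value} (hf : PolyTime f) :
    PolyTime fun c => decide (θ.Holds (f c) v) := by
  have hd : PolyTime fun c => enc (f c) := .comp .code hf
  have hn := dataIsPair.comp hd
  have h1 := dataToInt.comp (dataFst.comp hd)
  have h2 := dataToInt.comp (dataSnd.comp hd)
  have heq := PolyTime.eq enc_injective_value hf (.const v)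
  cases θ
  case eq => exact heq.ofIff fun c => by simp [CmpOp.holds_eq]
  case ne => exact heq.not.ofIff fun c => by simp [CmpOp.holds_ne]
  all_goals
    cases v with
    | name m => exact (PolyTime.const false).ofIff fun c => by cases f c <;> simp [CmpOp.Holds]
    | num q => ?_
  all_goals
    have hle := (h1.intMul (.const (q.den : ℤ))).intLe ((PolyTime.const q.num).intMul h2)
    have hge := ((PolyTime.const q.num).intMul h2).intLe (h1.intMul (.const (q.den : ℤ)))
  · refine (hn.and hge.not).ofIff fun c => ?_
    simp only [Bool.and_eq_true, Bool.not_eq_true', decide_eq_false_iff_not]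
    cases f c <;> simp [CmpOp.Holds, Rat.lt_iff, enc, Value.code, Data.fst, Data.snd, Data.toInt,
      Data.isPairB]
  · refine (hn.and hle.not).ofIff fun c => ?_
    simp only [Bool.and_eq_true, Bool.not_eq_true', decide_eq_false_iff_not]
    cases f c <;> simp [CmpOp.Holds, Rat.lt_iff, enc, Value.code, Data.fst, Data.snd, Data.toInt,
      Data.isPairB]
  · refine (hn.and hle).ofIff fun c => ?_
    simp only [Bool.and_eq_true, decide_eq_true_eq]
    cases f c <;> simp [CmpOp.Holds, Rat.le_iff, enc, Value.code, Data.fst, Data.snd, Data.toInt,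
      Data.isPairB]
  · refine (hn.and hge).ofIff fun c => ?_
    simp only [Bool.and_eq_true, decide_eq_true_eq]
    cases f c <;> simp [CmpOp.Holds, Rat.le_iff, enc, Value.code, Data.fst, Data.snd, Data.toInt,
      Data.isPairB]

theorem PolyTime.posValue {S : Schema} {as : List (DBAtom S)} (p : Pos as) :
    PolyTime p.value :=
  .getD (PolyTime.id'.getD p.1 rfl) p.2 rfl

theorem PolyTime.valuation {S : Schema} (as : List (DBAtom S)) (x : ℕ) :
    PolyTime fun τ => valuation as τ x := by
  by_cases h : ∃ p : Pos as, p.var = x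
  · exact (PolyTime.posValue h.choose).congr fun τ => by rw [DBFix.valuation, dif_pos h]
  · exact (PolyTime.const (.name 0)).congr fun τ => by rw [DBFix.valuation, dif_neg h]

open Classical in
theorem PolyTime.builtInHolds {S : Schema} (as : List (DBAtom S)) (b : BuiltIn) :
    PolyTime fun τ => decide (b.Holds (DBFix.valuation as τ)) := by
  cases b with
  | cmp x θ v => exact .holds θ v (.valuation as x)
  | eq x y =>
    exact (PolyTime.eq enc_injective_value (.valuation as x) (.valuation as y)).ofIff fun τ => by
      simp [BuiltIn.Holds]

open Classical in
theorem PolyTime.isViolation {S : Schema} (ic : LinearDenial S) :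
    PolyTime fun τ => decide (IsViolation ic τ) := by
  have h1 : PolyTime fun τ => (Finset.univ : Finset (Pos ic.atoms)).toList.all fun p =>
      decide (p.value τ = DBFix.valuation ic.atoms τ p.var) :=
    .allConst _ fun p _ => .eq enc_injective_value (.posValue p) (.valuation ic.atoms p.var)
  have h2 : PolyTime fun τ => ic.builtIns.all fun b =>
      decide (b.Holds (DBFix.valuation ic.atoms τ)) :=
    .allConst _ fun b _ => .builtInHolds ic.atoms b
  exact (h1.and h2).ofIff fun τ => by simp [IsViolation]

end

/-! ### The repair algorithm -/

section
variable {S : Schema} (IC : Finset (LinearDenial S)) (M : ℕ)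

open Classical in
/-- The only value that the algorithm ever writes at the fixable attribute `A`: a number beyond all
constants (`M` being a bound for their absolute values) in the direction that makes the
comparisons at `A` false. -/
noncomputable def target (A : S.Attr) : ℤ :=
  if ComparedBy IC {.gt, .ge, .ne} A then -M else M

/-- Cells of a database, with their weights. A cell is given by the number of a table, the position
of a column, and a row. -/
abbrev Cell : Type := ((ℕ × ℕ) × List Value) × ℕ

/-- The cell at the position `i` of a row `r` of `R`. Its weight is the cost of moving its value to
the target. -/
noncomputable def cell (R : S.Rel) (i : Fin (S.arity R)) (r : List Value) : Cell :=
  (((R, i), r), (target IC M (S.attr R i) - (r.getD i (.name 0)).toRat.num).natAbs ^ 2)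

open Classical in
/-- The positions at which a change of the value can resolve a violation of `ic`. -/
noncomputable def comparedPos (ic : LinearDenial S) : List (Pos ic.atoms) :=
  (Finset.univ.filter fun p : Pos ic.atoms =>
    p.attr ∈ S.fixable ∧ ∃ θ c, BuiltIn.cmp p.var θ c ∈ ic.builtIns).toList

/-- The cells at which a violation `τ` of `ic` can be resolved. -/
noncomputable def edge (ic : LinearDenial S) (τ : List (List Value)) : List Cell :=
  (comparedPos ic).map fun p => cell IC M (ic.atoms.get p.1).rel p.2 (τ.getD p.1 [])

open Classical in
/-- The hypergraph of all violations in a database. -/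
noncomputable def edges (db : Tables) : List (List Cell) :=
  IC.toList.flatMap fun ic =>
    ((tuples db (ic.atoms.map fun a => (a.rel : ℕ))).filter fun τ => IsViolation ic τ).map
      (edge IC M ic)

open Classical in
/-- The repaired row: the values of the cells that are fully paid are moved to their targets. -/
noncomputable def repairRow (y : List (Cell × ℕ)) (R : S.Rel) (r : List Value)
    (i : Fin (S.arity R)) : Value :=
  if S.attr R i ∈ S.fixable ∧ (cell IC M R i r).2 ≤ paid y (cell IC M R i r) then
    .num (target IC M (S.attr R i))
  else r.getD i (.name 0)

/-- The repaired database. -/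
noncomputable def repair (db : Tables) : Tables :=
  List.ofFn fun R : S.Rel => (db.getD R []).map fun r =>
    List.ofFn (repairRow IC M (payments Prod.snd (edges IC M db)) R r)

theorem enc_injective_cell : Function.Injective (enc : Cell → Data) :=
  enc_injective_prod (enc_injective_prod (enc_injective_prod enc_injective_nat enc_injective_nat)
    (enc_injective_list enc_injective_value)) enc_injective_nat

theorem PolyTime.cell (R : S.Rel) (i : Fin (S.arity R)) : PolyTime (cell IC M R i) := by
  refine ((PolyTime.const ((R : ℕ), (i : ℕ))).pair .id').pair (.of_natCast ?_)
  have h := (PolyTime.const (target IC M (S.attr R i))).intSub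
    (PolyTime.id'.getD (β := Value) (d := .name 0) i rfl).toRatNum
  exact (h.intMul h).congr fun r => by simp [sq]

theorem PolyTime.edge (ic : LinearDenial S) : PolyTime (edge IC M ic) :=
  .mapConst _ fun p _ => (PolyTime.cell IC M _ p.2).comp (PolyTime.id'.getD p.1 rfl)

theorem PolyTime.edges : PolyTime (edges IC M) := by
  unfold DBFix.edges
  induction IC.toList with
  | nil => exact .const []
  | cons ic l ih =>
    simp only [List.flatMap_cons]
    exact (((PolyTime.tuples _).filter ((PolyTime.isViolation ic).comp PolyTime.id'.snd)).map
      ((PolyTime.edge IC M ic).comp PolyTime.id'.snd)).append ih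

theorem PolyTime.repair : PolyTime (repair IC M) := by
  refine .ofFn fun R => .map (PolyTime.id'.getD R rfl) (.ofFn fun i => ?_)
  have hc := (PolyTime.cell IC M R i).comp (PolyTime.id' (α := Tables × List Value)).snd
  have hy := (PolyTime.payments enc_injective_cell (PolyTime.id' (α := Cell)).snd).comp
    ((PolyTime.edges IC M).comp (PolyTime.id' (α := Tables × List Value)).fst)
  have hv : PolyTime fun x : Tables × List Value => x.2.getD i (.name 0) :=
    PolyTime.id'.snd.getD i rfl
  by_cases hA : S.attr R i ∈ S.fixable
  · refine ((hc.snd.natLe (.paid enc_injective_cell hy hc)).ite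
      (.const (.num (target IC M (S.attr R i)))) hv).congr fun x => ?_
    simp [repairRow, hA]
  · exact hv.congr fun x => by simp [repairRow, hA]

/-! ### Comparisons at fixable attributes -/

/-- All numbers in comparisons of `IC` have absolute value less than `M`. -/
def IsBound : Prop :=
  ∀ ic ∈ IC, ∀ x θ q, BuiltIn.cmp x θ (.num q) ∈ ic.builtIns → |q| < M

theorem exists_isBound : ∃ M, IsBound IC M := by
  let f : BuiltIn → ℕ
    | .cmp _ _ (.num q) => ⌊|q|⌋₊ + 1
    | _ => 0
  refine ⟨∑ ic ∈ IC, (ic.builtIns.map f).sum, fun ic hic x θ q hb => ?_⟩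
  have h1 : f (.cmp x θ (.num q)) ≤ (ic.builtIns.map f).sum :=
    List.single_le_sum (fun _ _ => Nat.zero_le _) _ (List.mem_map_of_mem hb)
  have h2 : (ic.builtIns.map f).sum ≤ ∑ ic ∈ IC, (ic.builtIns.map f).sum :=
    Finset.single_le_sum (f := fun ic : LinearDenial S => (ic.builtIns.map f).sum)
      (fun _ _ => Nat.zero_le _) hic
  calc |q| < (⌊|q|⌋₊ + 1 : ℕ) := by exact_mod_cast Nat.lt_floor_add_one _
    _ ≤ _ := by exact_mod_cast h1.trans h2

variable {IC M}

/-- What one-sidedness says about a single comparison: either the target is `M` and the comparison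
bounds the attribute from above (or is an equation), or the other way round. -/
theorem target_cases (hIC : IsLocal IC) {ic : LinearDenial S} (hic : ic ∈ IC) {p : Pos ic.atoms}
    {θ : CmpOp} {c : Value} (hb : BuiltIn.cmp p.var θ c ∈ ic.builtIns) :
    (target IC M p.attr = M ∧ (θ = .eq ∨ θ = .lt ∨ θ = .le)) ∨
      (target IC M p.attr = -M ∧ (θ = .eq ∨ θ = .gt ∨ θ = .ge)) := by
  have h : ∀ Θ : Set CmpOp, θ ∈ Θ → ComparedBy IC Θ p.attr :=
    fun Θ hΘ => ⟨ic, hic, p, rfl, θ, hΘ, c, hb⟩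
  have h1 := hIC.one_sided p.attr
  by_cases hc : ComparedBy IC {.gt, .ge, .ne} p.attr
  · refine .inr ⟨by simp [target, hc], ?_⟩
    have := mt (h {.lt, .le, .ne}) fun h' => h1 ⟨h', hc⟩
    cases θ <;> simp_all
  · refine .inl ⟨by simp [target, hc], ?_⟩
    have := mt (h {.gt, .ge, .ne}) hc
    cases θ <;> simp_all

theorem not_holds_target (hIC : IsLocal IC) (hM : IsBound IC M) {ic : LinearDenial S}
    (hic : ic ∈ IC) {p : Pos ic.atoms} {θ : CmpOp} {c : Value}
    (hb : BuiltIn.cmp p.var θ c ∈ ic.builtIns) : ¬ θ.Holds (.num (target IC M p.attr)) c := by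
  cases c with
  | name n =>
    rcases target_cases (M := M) hIC hic hb with ⟨-, rfl | rfl | rfl⟩ | ⟨-, rfl | rfl | rfl⟩ <;>
      simp [CmpOp.Holds]
  | num q =>
    have hq := abs_lt.1 (hM ic hic _ _ _ hb)
    rcases target_cases (M := M) hIC hic hb with ⟨h, rfl | rfl | rfl⟩ | ⟨h, rfl | rfl | rfl⟩ <;>
      rw [h] <;> simp [CmpOp.Holds] <;> linarith

/-- Moving a value to the target costs at most a constant factor more than any other move that
resolves the violation: integers being involved, the latter has at least length one, and it has to
reach a constant between `-M` and `M`. -/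
theorem target_sub_sq_le (hIC : IsLocal IC) (hM : IsBound IC M) {ic : LinearDenial S}
    (hic : ic ∈ IC) {p : Pos ic.atoms} {θ : CmpOp} {c : Value}
    (hb : BuiltIn.cmp p.var θ c ∈ ic.builtIns) {z z' : ℤ} (hz : θ.Holds (.num z) c)
    (hz' : ¬ θ.Holds (.num z') c) :
    (target IC M p.attr - z) ^ 2 ≤ (2 * M + 1) ^ 2 * (z - z') ^ 2 := by
  have hne : z ≠ z' := fun h => hz' (h ▸ hz)
  have hd : 1 ≤ |z - z'| := Int.one_le_abs (sub_ne_zero.2 hne)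
  have hM0 : (0 : ℤ) ≤ M := Int.natCast_nonneg M
  suffices h : |target IC M p.attr - z| ≤ (2 * M + 1) * |z - z'| by
    rw [← mul_pow]
    refine sq_le_sq.2 (h.trans_eq ?_)
    rw [abs_mul, abs_of_nonneg (by positivity : (0 : ℤ) ≤ 2 * M + 1)]
  suffices h : |target IC M p.attr - z| ≤ 2 * M + |z - z'| by nlinarith
  have hl := le_abs_self (z - z')
  have hr := neg_abs_le (z - z')
  cases c with
  | name n =>
    rcases target_cases (M := M) hIC hic hb with ⟨-, rfl | rfl | rfl⟩ | ⟨-, rfl | rfl | rfl⟩ <;>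
      simp [CmpOp.Holds] at hz
  | num q =>
    obtain ⟨hq1, hq2⟩ := abs_lt.1 (hM ic hic _ _ _ hb)
    have low : ∀ m : ℤ, (q : ℚ) ≤ m → -(M : ℤ) < m := fun m h => by
      exact_mod_cast (hq1.trans_le h : -(M : ℚ) < m)
    have high : ∀ m : ℤ, (m : ℚ) ≤ q → m < (M : ℤ) := fun m h => by
      exact_mod_cast (h.trans_lt hq2 : (m : ℚ) < M)
    rcases target_cases (M := M) hIC hic hb with ⟨h, rfl | rfl | rfl⟩ | ⟨h, rfl | rfl | rfl⟩ <;>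
      rw [h] <;> simp only [CmpOp.Holds, Value.num.injEq, not_lt, not_le] at hz hz'
    · have := low z hz.ge; have := high z hz.le
      rw [abs_le]; constructor <;> omega
    · have := low z' hz'; have := high z hz.le
      rw [abs_le]; constructor <;> omega
    · have := low z' hz'.le; have := high z hz
      rw [abs_le]; constructor <;> omega
    · have := low z hz.ge; have := high z hz.le
      rw [abs_le]; constructor <;> omega
    · have := low z hz.le; have := high z' hz'
      rw [abs_le]; constructor <;> omega
    · have := low z hz; have := high z' hz'.le
      rw [abs_le]; constructor <;> omega

end

/-! ### Square distances -/

section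
variable {S : Schema}

open Classical in
/-- The fixable cells of an instance. -/
noncomputable def fixableCells (D : Instance S) :
    Finset ((R : S.Rel) × Row S R × Fin (S.arity R)) :=
  Finset.univ.sigma fun R => D.rows R ×ˢ Finset.univ.filter fun i => S.attr R i ∈ S.fixable

theorem mem_fixableCells {D : Instance S} {R : S.Rel} {t : Row S R} {i : Fin (S.arity R)} :
    (⟨R, t, i⟩ : (R : S.Rel) × Row S R × Fin (S.arity R)) ∈ fixableCells D ↔
      t ∈ D.rows R ∧ S.attr R i ∈ S.fixable := by
  simp [fixableCells]

theorem SameRigid.sameKey {R : S.Rel} {t t' : Row S R} (h : SameRigid t t') : SameKey t t' :=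
  fun i hi => h i (S.key_rigid R i hi)

theorem sqDist_eq {D D' : Instance S} (hD' : D'.SatisfiesKeys) (u : ∀ R, Row S R → Row S R)
    (hu : ∀ R, ∀ t ∈ D.rows R, u R t ∈ D'.rows R ∧ SameRigid t (u R t)) :
    sqDist D D' = ∑ x ∈ fixableCells D,
      ((x.2.1 x.2.2).toRat - (u x.1 x.2.1 x.2.2).toRat) ^ 2 := by
  classical
  simp only [sqDist, fixableCells, Finset.sum_sigma, Finset.sum_product]
  refine Finset.sum_congr rfl fun R _ => Finset.sum_congr rfl fun t ht => ?_
  obtain ⟨h1, h2⟩ := hu R t ht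
  have h3 : (D'.rows R).filter (SameKey t) = {u R t} := by
    ext t'
    simp only [Finset.mem_filter, Finset.mem_singleton]
    constructor
    · rintro ⟨h4, h5⟩
      exact hD' R _ h4 _ h1 fun i hi => (h5 i hi).symm.trans (h2.sameKey i hi)
    · rintro rfl
      exact ⟨h1, h2.sameKey⟩
  convert Finset.sum_singleton (rowDist t) (u R t) using 2
  rw [rowDist]

variable (IC : Finset (LinearDenial S)) (M : ℕ)

theorem cell_injective :
    Function.Injective fun x : (R : S.Rel) × Row S R × Fin (S.arity R) =>
      cell IC M x.1 x.2.2 (List.ofFn x.2.1) := by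
  rintro ⟨R, t, i⟩ ⟨R', t', i'⟩ h
  simp only [cell, Prod.mk.injEq] at h
  obtain ⟨⟨⟨hR, hi⟩, ht⟩, -⟩ := h
  obtain rfl := Fin.ext hR
  obtain rfl := Fin.ext hi
  rw [List.ofFn_injective ht]

theorem cell_weight {R : S.Rel} {t : Row S R} {i : Fin (S.arity R)} {z : ℤ} (h : t i = .num z) :
    ((cell IC M R i (List.ofFn t)).2 : ℤ) = (target IC M (S.attr R i) - z) ^ 2 := by
  simp [cell, h, Value.toRat]

/-! ### Correctness of the repair -/

theorem repairRow_cases (y : List (Cell × ℕ)) (R : S.Rel) (t : Row S R) (i : Fin (S.arity R)) :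
    repairRow IC M y R (List.ofFn t) i = t i ∨ (S.attr R i ∈ S.fixable ∧
      repairRow IC M y R (List.ofFn t) i = .num (target IC M (S.attr R i))) := by
  by_cases h : S.attr R i ∈ S.fixable ∧
      (cell IC M R i (List.ofFn t)).2 ≤ paid y (cell IC M R i (List.ofFn t))
  · exact .inr ⟨h.1, by simp only [repairRow, if_pos h]⟩
  · exact .inl (by simp [repairRow, if_neg h])

theorem sameRigid_repairRow (y : List (Cell × ℕ)) (R : S.Rel) (t : Row S R) :
    SameRigid t (repairRow IC M y R (List.ofFn t)) := fun i hi =>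
  ((repairRow_cases IC M y R t i).resolve_right fun h => hi h.1).symm

open Classical in
/-- The instance in which all rows of `D` are repaired with respect to the payments `y`. -/
noncomputable def Instance.repaired (D : Instance S) (y : List (Cell × ℕ)) : Instance S where
  rows R := (D.rows R).image fun t => repairRow IC M y R (List.ofFn t)
  typed R t' ht' i hi := by
    obtain ⟨t, ht, rfl⟩ := Finset.mem_image.1 ht'
    rcases repairRow_cases IC M y R t i with h | ⟨-, h⟩
    · rw [h]; exact D.typed R t ht i hi
    · exact ⟨_, h⟩

theorem mem_repaired {D : Instance S} {y : List (Cell × ℕ)} {R : S.Rel} {t' : Row S R} :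
    t' ∈ (D.repaired IC M y).rows R ↔
      ∃ t ∈ D.rows R, repairRow IC M y R (List.ofFn t) = t' := by
  simp [Instance.repaired]

theorem eq_of_sameKey_repairRow {D : Instance S} (hD : D.SatisfiesKeys) (y : List (Cell × ℕ))
    {R : S.Rel} {t t' : Row S R} (ht : t ∈ D.rows R) (ht' : t' ∈ D.rows R)
    (h : SameKey (repairRow IC M y R (List.ofFn t)) (repairRow IC M y R (List.ofFn t'))) :
    t = t' :=
  hD R t ht t' ht' fun i hi => by
    rw [(sameRigid_repairRow IC M y R t).sameKey i hi, h i hi,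
      ← (sameRigid_repairRow IC M y R t').sameKey i hi]

variable {IC M}

theorem mem_edges {L : Listing S} {ic : LinearDenial S} (hic : ic ∈ IC)
    (t : (j : Fin ic.atoms.length) → Row S (ic.atoms.get j).rel) (ht : ∀ j, t j ∈ L _)
    (hv : IsViolation ic (List.ofFn fun j => List.ofFn (t j))) :
    edge IC M ic (List.ofFn fun j => List.ofFn (t j)) ∈ edges IC M L.tables := by
  simp only [edges, List.mem_flatMap, Finset.mem_toList, List.mem_map, List.mem_filter,
    decide_eq_true_eq]
  exact ⟨ic, hic, _, ⟨(mem_tuples L ic.atoms _).2 ⟨t, ht, rfl⟩, hv⟩, rfl⟩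

theorem exists_of_mem_edges {L : Listing S} {E : List Cell} (hE : E ∈ edges IC M L.tables) :
    ∃ ic ∈ IC, ∃ t : (j : Fin ic.atoms.length) → Row S (ic.atoms.get j).rel, (∀ j, t j ∈ L _) ∧
      IsViolation ic (List.ofFn fun j => List.ofFn (t j)) ∧
      E = edge IC M ic (List.ofFn fun j => List.ofFn (t j)) := by
  simp only [edges, List.mem_flatMap, Finset.mem_toList, List.mem_map, List.mem_filter,
    decide_eq_true_eq] at hE
  obtain ⟨ic, hic, τ, ⟨hτ, hv⟩, rfl⟩ := hE
  obtain ⟨t, ht, rfl⟩ := (mem_tuples L ic.atoms _).1 hτ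
  exact ⟨ic, hic, t, ht, hv, rfl⟩

theorem mem_comparedPos {ic : LinearDenial S} {p : Pos ic.atoms} :
    p ∈ comparedPos ic ↔
      p.attr ∈ S.fixable ∧ ∃ θ c, BuiltIn.cmp p.var θ c ∈ ic.builtIns := by
  simp [comparedPos]

theorem mem_edge_ofFn {ic : LinearDenial S}
    (t : (j : Fin ic.atoms.length) → Row S (ic.atoms.get j).rel) (e : Cell) :
    e ∈ edge IC M ic (List.ofFn fun j => List.ofFn (t j)) ↔
      ∃ p ∈ comparedPos ic, cell IC M (ic.atoms.get p.1).rel p.2 (List.ofFn (t p.1)) = e := by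
  simp [edge]

theorem comparedPos_ne_nil (hIC : IsLocal IC) {ic : LinearDenial S} (hic : ic ∈ IC) :
    comparedPos ic ≠ [] := by
  obtain ⟨b, hb, p, hp, hA⟩ := hIC.fixable_builtIn ic hic
  cases b with
  | eq x y => exact absurd hA (hIC.eq_rigid ic hic x y hb p hp)
  | cmp x θ c =>
    obtain rfl : p.var = x := hp
    exact List.ne_nil_of_mem (mem_comparedPos.2 ⟨hA, θ, c, hb⟩)

/-- Rows that agree on all rigid attributes with rows that join properly join properly. -/
theorem join_of_sameRigid (hIC : IsLocal IC) {ic : LinearDenial S} (hic : ic ∈ IC)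
    {t s : (j : Fin ic.atoms.length) → Row S (ic.atoms.get j).rel}
    (hts : ∀ j, SameRigid (t j) (s j))
    (h : ∀ p q : Pos ic.atoms, p.var = q.var → t p.1 p.2 = t q.1 q.2) (p q : Pos ic.atoms)
    (hpq : p.var = q.var) : s p.1 p.2 = s q.1 q.2 := by
  by_cases hne : p = q
  · rw [hne]
  · obtain ⟨hp, hq⟩ := hIC.join_rigid ic hic p q hne hpq
    exact (hts p.1 p.2 hp).symm.trans ((h p q hpq).trans (hts q.1 q.2 hq))

/-- A violation in the repaired instance would stem from a violation in `D`, at which one of the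
compared values has been moved to its target; but there the comparison is false. -/
theorem satisfies_repaired (hIC : IsLocal IC) (hM : IsBound IC M) {D : Instance S} {L : Listing S}
    (hL : L.Lists D) {ic : LinearDenial S} (hic : ic ∈ IC) :
    (D.repaired IC M (payments Prod.snd (edges IC M L.tables))).Satisfies ic := by
  set y := payments Prod.snd (edges IC M L.tables) with hy
  rintro ⟨ν, hatoms, hb⟩
  have hrow : ∀ j : Fin ic.atoms.length, ∃ t ∈ D.rows (ic.atoms.get j).rel,
      repairRow IC M y _ (List.ofFn t) = fun i => ν ((ic.atoms.get j).args i) := fun j =>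
    (mem_repaired IC M).1 (hatoms _ (List.get_mem _ _))
  choose t ht hν using hrow
  have hν' : ∀ p : Pos ic.atoms,
      repairRow IC M y _ (List.ofFn (t p.1)) p.2 = ν p.var := fun p => congrFun (hν p.1) p.2
  have hjoin : ∀ p q : Pos ic.atoms, p.var = q.var → t p.1 p.2 = t q.1 q.2 := by
    refine join_of_sameRigid hIC hic
      (t := fun j => repairRow IC M y _ (List.ofFn (t j))) (fun j i hi => ?_) fun p q hpq => ?_
    · exact (sameRigid_repairRow IC M y _ (t j) i hi).symm
    · exact (hν' p).trans ((congrArg ν hpq).trans (hν' q).symm)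
  -- no compared value has been moved to its target
  have hmoved : ∀ p : Pos ic.atoms, (∃ θ c, BuiltIn.cmp p.var θ c ∈ ic.builtIns) →
      repairRow IC M y _ (List.ofFn (t p.1)) p.2 ≠ .num (target IC M p.attr) := by
    rintro p ⟨θ, c, hc⟩ h
    refine not_holds_target hIC hM hic hc ?_
    rw [← h, hν' p]
    exact hb _ hc
  have hval : ∀ p : Pos ic.atoms, valuation ic.atoms (List.ofFn fun j => List.ofFn (t j)) p.var =
      t p.1 p.2 := fun p => by
    rw [valuation_var (fun p q hpq => by simpa only [Pos.value_ofFn] using hjoin p q hpq),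
      Pos.value_ofFn]
  have hrigid : ∀ p : Pos ic.atoms, p.attr ∉ S.fixable → t p.1 p.2 = ν p.var := fun p hp =>
    (sameRigid_repairRow IC M y _ (t p.1) p.2 hp).trans (hν' p)
  have hviol : IsViolation ic (List.ofFn fun j => List.ofFn (t j)) := by
    refine ⟨fun p => by rw [hval, Pos.value_ofFn], fun b hmem => ?_⟩
    have hbν := hb b hmem
    cases b with
    | eq x z =>
      obtain ⟨p, rfl⟩ := ic.safe _ hmem x (by simp [BuiltIn.vars])
      obtain ⟨q, rfl⟩ := ic.safe _ hmem z (by simp [BuiltIn.vars])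
      simp only [BuiltIn.Holds, hval] at hbν ⊢
      rw [hrigid p (hIC.eq_rigid ic hic _ _ hmem p (.inl rfl)),
        hrigid q (hIC.eq_rigid ic hic _ _ hmem q (.inr rfl)), hbν]
    | cmp x θ c =>
      obtain ⟨p, rfl⟩ := ic.safe _ hmem x (by simp [BuiltIn.vars])
      simp only [BuiltIn.Holds, hval] at hbν ⊢
      rwa [← (repairRow_cases IC M y _ (t p.1) p.2).resolve_right
        fun h => hmoved p ⟨θ, c, hmem⟩ h.2, hν' p]
  obtain ⟨e, he, hpaid⟩ := exists_paid Prod.snd (edges IC M L.tables) _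
    (mem_edges hic t (fun j => ((hL _).2 _).2 (ht j)) hviol)
    (by simpa [edge] using comparedPos_ne_nil hIC hic)
  obtain ⟨p, hp, rfl⟩ := (mem_edge_ofFn t e).1 he
  obtain ⟨hA, hcmp⟩ := mem_comparedPos.1 hp
  exact hmoved p hcmp (if_pos ⟨hA, hpaid⟩)

theorem isFix_repaired (hIC : IsLocal IC) (hM : IsBound IC M) {D : Instance S}
    (hD : D.SatisfiesKeys) {L : Listing S} (hL : L.Lists D) :
    IsFix IC D (D.repaired IC M (payments Prod.snd (edges IC M L.tables))) where
  rigid R t ht := ⟨_, (mem_repaired IC M).2 ⟨t, ht, rfl⟩, sameRigid_repairRow IC M _ R t⟩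
  rigid' R t' ht' := by
    obtain ⟨t, ht, rfl⟩ := (mem_repaired IC M).1 ht'
    exact ⟨t, ht, sameRigid_repairRow IC M _ R t⟩
  keys R t₁ h₁ t₂ h₂ h := by
    obtain ⟨t, ht, rfl⟩ := (mem_repaired IC M).1 h₁
    obtain ⟨t', ht', rfl⟩ := (mem_repaired IC M).1 h₂
    rw [eq_of_sameKey_repairRow IC M hD _ ht ht' h]
  ics _ hic := satisfies_repaired hIC hM hL hic

/-! ### The approximation ratio -/

/-- Every fix moves one of the cells in each edge, by a distance that is comparable with the
distance to the target. -/
theorem exists_moved (hIC : IsLocal IC) (hM : IsBound IC M) {D D' : Instance S}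
    (hD' : IsFix IC D D') (u : ∀ R, Row S R → Row S R)
    (hu : ∀ R, ∀ t ∈ D.rows R, u R t ∈ D'.rows R ∧ SameRigid t (u R t))
    {ic : LinearDenial S} (hic : ic ∈ IC)
    (t : (j : Fin ic.atoms.length) → Row S (ic.atoms.get j).rel) (ht : ∀ j, t j ∈ D.rows _)
    (hv : IsViolation ic (List.ofFn fun j => List.ofFn (t j))) :
    ∃ p ∈ comparedPos ic, ((cell IC M _ p.2 (List.ofFn (t p.1))).2 : ℚ) ≤
      (2 * M + 1) ^ 2 * ((t p.1 p.2).toRat - (u _ (t p.1) p.2).toRat) ^ 2 := by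
  set τ := List.ofFn fun j => List.ofFn (t j) with hτ
  set τ' := List.ofFn fun j => List.ofFn (u _ (t j)) with hτ'
  have hval : ∀ p : Pos ic.atoms, valuation ic.atoms τ p.var = t p.1 p.2 := fun p => by
    rw [← hv.1, Pos.value_ofFn]
  have hjoin := join_of_sameRigid hIC hic (t := t) (s := fun j => u _ (t j))
    (fun j => (hu _ _ (ht j)).2) fun p q hpq => by rw [← hval, ← hval, hpq]
  have hval' : ∀ p : Pos ic.atoms, valuation ic.atoms τ' p.var = u _ (t p.1) p.2 := fun p => by
    rw [valuation_var (fun p q hpq => by simpa only [hτ', Pos.value_ofFn] using hjoin p q hpq),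
      Pos.value_ofFn]
  have hrigid : ∀ p : Pos ic.atoms, p.attr ∉ S.fixable → u _ (t p.1) p.2 = t p.1 p.2 :=
    fun p hp => ((hu _ _ (ht p.1)).2 p.2 hp).symm
  obtain ⟨b, hmem, hb⟩ : ∃ b ∈ ic.builtIns, ¬ b.Holds (valuation ic.atoms τ') := by
    by_contra! h
    refine hD'.ics ic hic ⟨valuation ic.atoms τ', fun a ha => ?_, h⟩
    obtain ⟨j, rfl⟩ := List.get_of_mem ha
    convert (hu _ _ (ht j)).1 using 1
    funext i
    exact hval' ⟨j, i⟩
  have hbτ := hv.2 b hmem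
  cases b with
  | eq x z =>
    obtain ⟨p, rfl⟩ := ic.safe _ hmem x (by simp [BuiltIn.vars])
    obtain ⟨q, rfl⟩ := ic.safe _ hmem z (by simp [BuiltIn.vars])
    simp only [BuiltIn.Holds, hval, hval'] at hbτ hb
    rw [hrigid p (hIC.eq_rigid ic hic _ _ hmem p (.inl rfl)),
      hrigid q (hIC.eq_rigid ic hic _ _ hmem q (.inr rfl))] at hb
    exact absurd hbτ hb
  | cmp x θ c =>
    obtain ⟨p, rfl⟩ := ic.safe _ hmem x (by simp [BuiltIn.vars])
    simp only [BuiltIn.Holds, hval, hval'] at hbτ hb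
    have hA : p.attr ∈ S.fixable := by
      by_contra hA
      exact hb (by rwa [hrigid p hA])
    obtain ⟨z, hz⟩ := D.typed _ _ (ht p.1) p.2 hA
    obtain ⟨z', hz'⟩ := D'.typed _ _ (hu _ _ (ht p.1)).1 p.2 hA
    refine ⟨p, mem_comparedPos.2 ⟨hA, θ, c, hmem⟩, ?_⟩
    have h := target_sub_sq_le hIC hM hic hmem (hz ▸ hbτ) (hz' ▸ hb)
    have hw : ((cell IC M _ p.2 (List.ofFn (t p.1))).2 : ℤ) = (target IC M p.attr - z) ^ 2 :=
      cell_weight IC M hz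
    rw [← hw] at h
    rw [hz, hz']
    simp only [Value.toRat]
    exact_mod_cast h

theorem sqDist_repaired_le (hIC : IsLocal IC) (hM : IsBound IC M) {f : ℕ} (hf : 1 ≤ f)
    (hfIC : ∀ ic ∈ IC, (comparedPos ic).length ≤ f) {D : Instance S} (hD : D.SatisfiesKeys)
    {L : Listing S} (hL : L.Lists D) {D' : Instance S} (hD' : IsFix IC D D') :
    sqDist D (D.repaired IC M (payments Prod.snd (edges IC M L.tables))) ≤
      (f ^ 2 * (2 * M + 1) ^ 2 : ℕ) * sqDist D D' := by
  classical
  set y := payments Prod.snd (edges IC M L.tables) with hy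
  have hu : ∀ R, ∀ t : Row S R, ∃ t', t ∈ D.rows R → t' ∈ D'.rows R ∧ SameRigid t t' := by
    intro R t
    by_cases ht : t ∈ D.rows R
    · obtain ⟨t', h⟩ := hD'.rigid R t ht
      exact ⟨t', fun _ => h⟩
    · exact ⟨t, fun h => absurd h ht⟩
  choose u hu using hu
  let φ : (R : S.Rel) × Row S R × Fin (S.arity R) → Cell :=
    fun x => cell IC M x.1 x.2.2 (List.ofFn x.2.1)
  have hφ : Function.Injective φ := cell_injective IC M
  let d : (R : S.Rel) × Row S R × Fin (S.arity R) → ℚ :=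
    fun x => ((x.2.1 x.2.2).toRat - (u x.1 x.2.1 x.2.2).toRat) ^ 2
  -- the cells that `D'` moves far enough form a hitting set
  let H := (fixableCells D).filter fun x => ((φ x).2 : ℚ) ≤ (2 * M + 1) ^ 2 * d x
  -- the cells that are moved to their targets
  let U := (fixableCells D).filter fun x => (φ x).2 ≤ paid y (φ x)
  have hcover := sum_weight_paid_le (Prod.snd : Cell → ℕ) hf (Es := edges IC M L.tables)
    (fun E hE => by
      obtain ⟨ic, hic, t, -, -, rfl⟩ := exists_of_mem_edges hE
      simpa [edge] using hfIC ic hic)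
    (H.image φ)
    (fun E hE => by
      obtain ⟨ic, hic, t, ht, hv, rfl⟩ := exists_of_mem_edges hE
      have ht' : ∀ j, t j ∈ D.rows _ := fun j => ((hL _).2 _).1 (ht j)
      obtain ⟨p, hp, h⟩ := exists_moved hIC hM hD' u hu hic t ht' hv
      refine ⟨_, (mem_edge_ofFn t _).2 ⟨p, hp, rfl⟩, ?_⟩
      refine Finset.mem_image.2 ⟨⟨_, t p.1, p.2⟩, Finset.mem_filter.2 ⟨?_, h⟩, rfl⟩
      exact mem_fixableCells.2 ⟨ht' _, (mem_comparedPos.1 hp).1⟩)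
    (U.image φ)
    (fun e he => by
      obtain ⟨x, hx, rfl⟩ := Finset.mem_image.1 he
      exact (Finset.mem_filter.1 hx).2)
  rw [Finset.sum_image hφ.injOn, Finset.sum_image hφ.injOn] at hcover
  have hupper : sqDist D (D.repaired IC M y) = ∑ x ∈ U, ((φ x).2 : ℚ) := by
    rw [sqDist_eq (isFix_repaired hIC hM hD hL).keys (fun R t => repairRow IC M y R (List.ofFn t))
      fun R t ht => ⟨(mem_repaired IC M).2 ⟨t, ht, rfl⟩, sameRigid_repairRow IC M _ R t⟩,
      Finset.sum_filter]
    refine Finset.sum_congr rfl ?_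
    rintro ⟨R, t, i⟩ hx
    obtain ⟨ht, hA⟩ := mem_fixableCells.1 hx
    obtain ⟨z, hz⟩ := D.typed R t ht i hA
    by_cases h : (φ ⟨R, t, i⟩).2 ≤ paid y (φ ⟨R, t, i⟩)
    · have h1 : repairRow IC M y R (List.ofFn t) i = .num (target IC M (S.attr R i)) :=
        if_pos ⟨hA, h⟩
      have h2 : (((φ ⟨R, t, i⟩).2 : ℤ) : ℚ) = ((target IC M (S.attr R i) - z) ^ 2 : ℤ) :=
        congrArg _ (cell_weight IC M hz)
      rw [if_pos h]
      simp only [h1, hz, Value.toRat]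
      push_cast at h2
      rw [h2]
      ring
    · have h1 : repairRow IC M y R (List.ofFn t) i = t i := by
        simp only [repairRow]
        rw [if_neg fun h' => h h'.2]
        simp
      rw [if_neg h]
      simp [h1]
  calc sqDist D (D.repaired IC M y)
    _ = ((∑ x ∈ U, (φ x).2 : ℕ) : ℚ) := by rw [hupper]; push_cast; rfl
    _ ≤ ((f ^ 2 * ∑ x ∈ H, (φ x).2 : ℕ) : ℚ) := by exact_mod_cast hcover
    _ = f ^ 2 * ∑ x ∈ H, ((φ x).2 : ℚ) := by push_cast; rfl
    _ ≤ f ^ 2 * ∑ x ∈ H, (2 * M + 1) ^ 2 * d x := by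
      gcongr with x hx
      exact (Finset.mem_filter.1 hx).2
    _ ≤ f ^ 2 * ∑ x ∈ fixableCells D, (2 * M + 1) ^ 2 * d x := by
      gcongr ?_ * ?_
      exact Finset.sum_le_sum_of_subset_of_nonneg (Finset.filter_subset _ _)
        fun x _ _ => by positivity
    _ = (f ^ 2 * (2 * M + 1) ^ 2 : ℕ) * sqDist D D' := by
      rw [sqDist_eq hD'.keys u hu, ← Finset.mul_sum]
      push_cast
      ring

/-- The listing of the repaired instance that the algorithm produces. -/
theorem exists_listing_repaired {D : Instance S} (hD : D.SatisfiesKeys) {L : Listing S}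
    (hL : L.Lists D) :
    ∃ L' : Listing S, L'.Lists (D.repaired IC M (payments Prod.snd (edges IC M L.tables))) ∧
      L'.tables = repair IC M L.tables := by
  set y := payments Prod.snd (edges IC M L.tables) with hy
  refine ⟨fun R => (L R).map fun t => repairRow IC M y R (List.ofFn t), fun R => ⟨?_, fun t => ?_⟩,
    ?_⟩
  · refine (hL R).1.map_on fun t ht t' ht' h => ?_
    exact eq_of_sameKey_repairRow IC M hD y (((hL R).2 t).1 ht) (((hL R).2 t').1 ht')
      fun i _ => congrFun h i
  · rw [mem_repaired, List.mem_map]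
    simp only [(hL R).2]
  · rw [Listing.tables, repair]
    congr 1
    funext R
    rw [Listing.getD_tables, List.map_map, List.map_map]
    rfl

end

end DBFix

theorem mainTheorem8 (S : Schema) (IC : Finset (LinearDenial S)) (hIC : IsLocal IC) :
    ∃ (c : ℕ) (P : WProg) (p : Polynomial ℕ),
      ∀ D : Instance S, D.SatisfiesKeys → ∀ L : Listing S, L.Lists D →
        ∃ (D' : Instance S) (L' : Listing S) (t : ℕ),
          L'.Lists D' ∧ RunsTo P L.code L'.code t ∧ t ≤ p.eval L.code.size ∧
          IsFix IC D D' ∧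
          ∀ D'' : Instance S, IsLSFix IC D D'' → sqDist D D' ≤ c * sqDist D D'' := by
  obtain ⟨M, hM⟩ := exists_isBound IC
  obtain ⟨p, hp⟩ := PolyTime.repair IC M
  obtain ⟨P, hP⟩ := hp 0
  let f : ℕ := 1 + ∑ ic ∈ IC, (comparedPos ic).length
  refine ⟨f ^ 2 * (2 * M + 1) ^ 2, P, p, fun D hD L hL => ?_⟩
  obtain ⟨L', hL', htab⟩ := exists_listing_repaired (IC := IC) (M := M) hD hL
  obtain ⟨σ, t, h1, h2, -, h3⟩ := hP L.tables
    (Function.update (fun _ => .int 0) 0 L.code) (by simp [L.enc_tables])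
  refine ⟨_, L', t, hL', ⟨σ, h1, ?_⟩, ?_, isFix_repaired hIC hM hD hL, fun D'' hD'' => ?_⟩
  · rw [h2, ← htab, L'.enc_tables]
  · rwa [L.enc_tables] at h3
  · refine sqDist_repaired_le hIC hM (Nat.le_add_right _ _) (fun ic hic => ?_) hD hL hD''.1
    exact (Finset.single_le_sum (f := fun ic : LinearDenial S => (comparedPos ic).length)
      (fun _ _ => Nat.zero_le _) hic).trans (Nat.le_add_left _ _)
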